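/- Let $(\Omega,\mathcal F,\mathbb P)$ be a probability space, let $\theta:\Omega\to\Omega$ be a measurable, measure-preserving (not necessarily invertible) transformation, and let $\mathcal H$ be a real Hilbert space with norm $|\cdot|_{\mathcal H}$. Let $\mathbf K$ be the Perron–Frobenius operator on $L^2(\Omega,\mathcal H)$, defined by $$\int_\Omega \langle X, Y\circ\theta\rangle\,d\mathbb P=\int_\Omega\langle \mathbf K X,Y\rangle\,d\mathbb P\qquad\text{for all }X,Y\in L^2(\Omega,\mathcal H).$$ For $X:\Omega\to\mathcal H$ put $S_n(X)=\sum_{k=0}^{n-1}X\circ\theta^k$, let $L(x)=\max(\log x,1)$ with $L(0)=1$, and let $$\mathcal M_2(X)=\sup_{n\ge1}\frac{|S_n(X)|_{\mathcal H}}{\sqrt{nL(L(n))}}\in[0,\infty].$$ For every $1<p<2$ there is a constant $C_p>0$, depending only on $p$, such that for all such $(\Omega,\mathcal F,\mathbb P,\theta)$ and $\mathcal H$ and every $X\in L^2(\Omega,\mathcal H)$ with $$\sum_{n\ge1}\frac{\|\mathbf K^nX\|_2}{\sqrt n}<\infty \qquad (*)$$ one has $$\|\mathcal M_2(X)\|_p\le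 C_p\Big(\|X\|_2+\sum_{n\ge1}\frac{\|\mathbf K^nX\|_2}{\sqrt n}\Big).$$ Moreover, for every $X\in L^2(\Omega,\mathcal H)$ satisfying $(*)$ there is $d\in L^2(\Omega,\mathcal H)$ with $\mathbb E(d\mid\theta^{-1}\mathcal F)=0$ (so that $(d\circ\theta^n)_{n\ge0}$ is a stationary sequence of reverse martingale differences) such that, almost surely, $$|S_n(X)-S_n(d)|_{\mathcal H}=o\big(\sqrt{nL(L(n))}\big)\qquad(n\to\infty),$$ and $(X\circ\theta^n)_{n\ge0}$ satisfies the compact law of the iterated logarithm: almost surely, the sequence $\big(S_n(X)/\sqrt{2nL(L(n))}\big)_{n\ge1}$ is relatively compact in $\mathcal H$. -/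

import Mathlib

open MeasureTheory Filter Asymptotics
open scoped ENNReal

universe u v

namespace LILDynSys

/-- The function `L = max(log, 1)`. -/
noncomputable def L (x : ℝ) : ℝ := max (Real.log x) 1

/-- The normalisation `√(n L(L(n)))`. -/
noncomputable def lilNorm (n : ℕ) : ℝ := √((n : ℝ) * L (L (n : ℝ)))

/-- The maximal function `M₂(X) = sup_{n ≥ 1} |S_n(X)| / √(n L(L(n)))`, with values in `[0, ∞]`,
where `S_n(X) = ∑_{k < n} X ∘ θ^k` is the Birkhoff sum. -/
noncomputable def maximalFunction {Ω : Type u} {H : Type v} [NormedAddCommGroup H]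
    (θ : Ω → Ω) (X : Ω → H) (ω : Ω) : ℝ≥0∞ :=
  ⨆ (n : ℕ) (_ : 1 ≤ n), ‖birkhoffSum θ X n ω‖ₑ / ENNReal.ofReal (lilNorm n)

/-- The stationary sequence `(X ∘ θ^n)` satisfies the compact law of the iterated logarithm:
almost surely, `(S_n(X) / √(2 n L(L(n))))_{n ≥ 1}` is relatively compact. -/
def CompactLIL {Ω : Type u} [MeasurableSpace Ω] {H : Type v} [NormedAddCommGroup H]
    [NormedSpace ℝ H] (μ : Measure Ω) (θ : Ω → Ω) (X : Ω → H) : Prop :=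
  ∀ᵐ ω ∂μ, IsCompact (closure
    ((fun n : ℕ => (√(2 * (n : ℝ) * L (L (n : ℝ))))⁻¹ • birkhoffSum θ X n ω) '' Set.Ici 1))

section PerronFrobenius

variable {Ω : Type u} [MeasurableSpace Ω] {μ : Measure Ω}
  {H : Type v} [NormedAddCommGroup H] [InnerProductSpace ℝ H] [CompleteSpace H] {θ : Ω → Ω}

/-- The Perron–Frobenius operator on `L²(Ω, H)`: the adjoint of the composition operator
`Y ↦ Y ∘ θ`. -/
noncomputable def perronFrobenius (hθ : MeasurePreserving θ μ μ) : Lp H 2 μ →L[ℝ] Lp H 2 μ :=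
  ContinuousLinearMap.adjoint
    (Lp.compMeasurePreservingₗᵢ ℝ (E := H) (p := 2) θ hθ).toContinuousLinearMap

/-- The defining duality `∫ ⟪X, Y ∘ θ⟫ dμ = ∫ ⟪K X, Y⟫ dμ` of the Perron–Frobenius operator. -/
theorem integral_perronFrobenius (hθ : MeasurePreserving θ μ μ) (X Y : Lp H 2 μ) :
    ∫ ω, inner ℝ (X ω) (Y (θ ω)) ∂μ = ∫ ω, inner ℝ (perronFrobenius hθ X ω) (Y ω) ∂μ := by
  rw [← L2.inner_def, perronFrobenius, ContinuousLinearMap.adjoint_inner_left, L2.inner_def]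
  refine integral_congr_ae ?_
  filter_upwards [Lp.coeFn_compMeasurePreserving Y hθ] with ω hω
  change _ = inner ℝ (X ω) (Lp.compMeasurePreserving θ hθ Y ω)
  rw [hω]
  rfl

/-- The norm `‖Kⁿ X‖₂`. -/
noncomputable def normIter (hθ : MeasurePreserving θ μ μ) {X : Ω → H} (hX : MemLp X 2 μ)
    (n : ℕ) : ℝ :=
  ‖(perronFrobenius hθ ^ n) (hX.toLp X)‖

/-- The condition `∑_{n ≥ 1} ‖Kⁿ X‖₂ / √n < ∞` (indexed by `n + 1`, `n ≥ 0`). -/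
def SeriesFinite (hθ : MeasurePreserving θ μ μ) {X : Ω → H} (hX : MemLp X 2 μ) : Prop :=
  Summable fun n : ℕ => normIter hθ hX (n + 1) / √((n : ℝ) + 1)

/-- The quantity `‖X‖₂ + ∑_{n ≥ 1} ‖Kⁿ X‖₂ / √n`. -/
noncomputable def seriesNorm (hθ : MeasurePreserving θ μ μ) {X : Ω → H} (hX : MemLp X 2 μ) : ℝ :=
  normIter hθ hX 0 + ∑' n : ℕ, normIter hθ hX (n + 1) / √((n : ℝ) + 1)

end PerronFrobenius

end LILDynSys

/-! Everything rests on a maximal inequality for reverse martingale differences, the `d` with `K d =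
0`; a general `X` is reached by expanding it into such differences.

Let `‖d‖₂ ≤ 1`. On the dyadic block `n ≈ 2 ^ j`, truncate `d` at a multiple `A` of `√(2 ^ j / L (L
(2 ^ j)))` and recentre it. Read backwards in time, the sums of the bounded part form a martingale,
and an exponential supermartingale gives a Freedman inequality as soon as the accumulated
conditional variance is controlled. That variance is a Birkhoff sum of an integrable function, so
Hopf's maximal theorem bounds it by `A ^ 2 * n` for all `n` at once, off a set of measure at most `1
/ A ^ 2`. The discarded part is handled by Markov's inequality, summably in `j` because the
truncation levels grow geometrically. The outcome is `measure_maximalFunction_gt_le`: the maximal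
function exceeds `3 * s * A` with probability at most `65 / A ^ 2 + c * exp (-s / 4)`. Taking `s` a
small power of the level leaves a polynomial tail of order as close to 2 as desired, hence moments
of every order `p < 2`.

Let `U` be the Koopman operator, so that `K` is its adjoint and `K U = 1`. Telescoping gives `X = ∑
U ^ n d_n` with `d_n = K ^ n X - U K ^ (n + 1) X`, where `K d_n = 0` and `‖d_n‖ ^ 2 = ‖K ^ n X‖ ^ 2
- ‖K ^ (n + 1) X‖ ^ 2`. The arithmetic-geometric inequality and Abel summation turn the hypothesis
into `∑ ‖d_n‖ < ∞` (`sum_norm_diffTerm_le`). The maximal function is subadditive and its `L^p` norm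
is `U`-invariant, so the maximal inequality passes to `X`.

The approximating difference is `D = ∑ d_n`. In `X - D = ∑ (U ^ n d_n - d_n)` every term is a
coboundary, negligible by Borel–Cantelli, and the tails are small in maximal norm, so a Banach
principle argument applies (`isNegligible_of_approx`). Compactness follows similarly: `d` is
`L²`-close to its projections on finite-dimensional subspaces, whose normalised sums stay in compact
balls. -/

namespace LILDynSys

/-! ### Scalar estimates: iterated logarithm, truncation levels, exponential inequality. -/

section Scalar

lemma one_le_L (x : ℝ) : 1 ≤ L x := le_max_right _ _

lemma L_pos (x : ℝ) : 0 < L x := zero_lt_one.trans_le (one_le_L x)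

lemma L_mono {x y : ℝ} (hx : 0 ≤ x) (h : x ≤ y) : L x ≤ L y := by
  rcases hx.eq_or_lt with rfl | hx
  · simp [L]
  · exact max_le_max_right _ (Real.log_le_log hx h)

lemma L_mul_le {c x : ℝ} (hc : 1 ≤ c) (hx : 0 < x) : L (c * x) ≤ L x + Real.log c := by
  have h : 0 ≤ Real.log c := Real.log_nonneg hc
  refine max_le ?_ ((one_le_L x).trans (by linarith))
  rw [Real.log_mul (by positivity) hx.ne', add_comm]
  exact add_le_add_left (le_max_left _ _) _

/-- Both applications of `L` lose at most the factor `17 / 10`, since `log 2` and `log (17 / 10)`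
are at most `7 / 10` and `L ≥ 1`. What matters is that the factor is below 2, so that `2 ^ j / LLtwo
j` still grows geometrically. -/
lemma LL_two_mul_le {x : ℝ} (hx : 0 < x) : L (L (2 * x)) ≤ 17 / 10 * L (L x) := by
  have h1 : L (2 * x) ≤ 17 / 10 * L x := by
    have := L_mul_le one_le_two hx
    have h2 := Real.log_two_lt_d9
    have := one_le_L x
    linarith
  have h3 := L_mul_le (c := 17 / 10) (by norm_num) (L_pos x)
  have h4 := Real.log_le_sub_one_of_pos (x := 17 / 10) (by norm_num)
  have h5 := one_le_L (L x)
  have h6 := L_mono (L_pos _).le h1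
  linarith

/-- The values of the iterated logarithm at powers of two. -/
noncomputable def LLtwo (j : ℕ) : ℝ := L (L (2 ^ j))

lemma one_le_LLtwo (j : ℕ) : 1 ≤ LLtwo j := one_le_L _

lemma LLtwo_pos (j : ℕ) : 0 < LLtwo j := L_pos _

lemma LLtwo_succ_le (j : ℕ) : LLtwo (j + 1) ≤ 17 / 10 * LLtwo j := by
  rw [LLtwo, pow_succ']
  exact LL_two_mul_le (by positivity)

lemma exp_neg_LLtwo_le (j : ℕ) : Real.exp (-LLtwo j) ≤ 4 / ((j : ℝ) + 1) := by
  have hpos : 0 < L (2 ^ j) := L_pos _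
  have h1 : Real.exp (-LLtwo j) ≤ (L (2 ^ j))⁻¹ := by
    rw [Real.exp_neg]
    refine inv_anti₀ hpos ?_
    calc L (2 ^ j) = Real.exp (Real.log (L (2 ^ j))) := (Real.exp_log hpos).symm
      _ ≤ _ := Real.exp_le_exp.2 (le_max_left _ _)
  refine h1.trans ?_
  rw [inv_eq_one_div, div_le_div_iff₀ hpos (by positivity)]
  have h2 : Real.log (2 ^ j) ≤ L (2 ^ j) := le_max_left _ _
  rw [Real.log_pow] at h2
  have h3 := one_le_L (2 ^ j)
  have h4 := Real.log_two_gt_d9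
  have h5 : (j : ℝ) * (1 / 2) ≤ j * Real.log 2 := by gcongr; linarith
  linarith

lemma summable_exp_neg_two_mul_LLtwo : Summable fun j => Real.exp (-(2 * LLtwo j)) := by
  have h : Summable fun j : ℕ => 16 * (1 / ((j : ℝ) + 1) ^ 2) := by
    have := (summable_nat_add_iff 1).2 (Real.summable_one_div_nat_pow.2 one_lt_two)
    simpa using this.mul_left 16
  refine h.of_nonneg_of_le (fun j => (Real.exp_pos _).le) fun j => ?_
  have h1 := exp_neg_LLtwo_le j
  calc Real.exp (-(2 * LLtwo j)) = Real.exp (-LLtwo j) ^ 2 := by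
        rw [← Real.exp_nat_mul]; congr 1; push_cast; ring
    _ ≤ (4 / ((j : ℝ) + 1)) ^ 2 := by gcongr
    _ = _ := by rw [div_pow]; ring

lemma lilNorm_mono : Monotone lilNorm := fun m n h => by
  have h' : (m : ℝ) ≤ n := by exact_mod_cast h
  have := L_mono (L_pos _).le (L_mono (Nat.cast_nonneg m) h')
  have := (L_pos (L (m : ℝ))).le
  unfold lilNorm
  gcongr

lemma sqrt_le_lilNorm (n : ℕ) : √(n : ℝ) ≤ lilNorm n :=
  Real.sqrt_le_sqrt (le_mul_of_one_le_right (Nat.cast_nonneg n) (one_le_L _))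

lemma lilNorm_nonneg (n : ℕ) : 0 ≤ lilNorm n := Real.sqrt_nonneg _

lemma one_le_lilNorm {n : ℕ} (hn : 1 ≤ n) : 1 ≤ lilNorm n := by
  refine le_trans ?_ (sqrt_le_lilNorm n)
  rw [Real.one_le_sqrt]
  exact_mod_cast hn

lemma lilNorm_pos {n : ℕ} (hn : 1 ≤ n) : 0 < lilNorm n := zero_lt_one.trans_le (one_le_lilNorm hn)

lemma lilNorm_two_pow (j : ℕ) : lilNorm (2 ^ j) = √(2 ^ j * LLtwo j) := by
  simp [lilNorm, LLtwo]

/-- The truncation levels, up to a factor. -/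
noncomputable def truncLevel (j : ℕ) : ℝ := √(2 ^ j / LLtwo j)

lemma truncLevel_pos (j : ℕ) : 0 < truncLevel j :=
  Real.sqrt_pos.2 (div_pos (by positivity) (LLtwo_pos j))

lemma truncLevel_mul_lilNorm (j : ℕ) : truncLevel j * lilNorm (2 ^ j) = 2 ^ j := by
  have := LLtwo_pos j
  rw [lilNorm_two_pow, truncLevel, ← Real.sqrt_mul (by positivity)]
  rw [show (2 : ℝ) ^ j / LLtwo j * (2 ^ j * LLtwo j) = (2 ^ j) ^ 2 by field_simp]
  exact Real.sqrt_sq (by positivity)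

lemma lilNorm_eq_truncLevel_mul (j : ℕ) : lilNorm (2 ^ j) = truncLevel j * LLtwo j := by
  have := LLtwo_pos j
  rw [lilNorm_two_pow, truncLevel]
  rw [show (2 : ℝ) ^ j * LLtwo j = (2 ^ j / LLtwo j) * (LLtwo j) ^ 2 by field_simp]
  rw [Real.sqrt_mul (by positivity), Real.sqrt_sq this.le]

lemma truncLevel_le (j : ℕ) : truncLevel j ≤ 15 / 16 * truncLevel (j + 1) := by
  have h1 := LLtwo_pos j
  have h2 := LLtwo_pos (j + 1)
  have h3 := LLtwo_succ_le j
  -- The ratio works because `17 / 10 ≤ 2 * (15 / 16) ^ 2 = 225 / 128`.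
  rw [truncLevel, truncLevel, show (15 / 16 : ℝ) = √((15 / 16) ^ 2) by
    rw [Real.sqrt_sq (by norm_num)], ← Real.sqrt_mul (by norm_num)]
  refine Real.sqrt_le_sqrt ?_
  rw [← mul_div_assoc, div_le_div_iff₀ h1 h2, pow_succ]
  have h4 : (2 : ℝ) ^ j * LLtwo (j + 1) ≤ 2 ^ j * (17 / 10 * LLtwo j) := by gcongr
  have h5 : 0 < (2 : ℝ) ^ j * LLtwo j := by positivity
  calc (2 : ℝ) ^ j * LLtwo (j + 1) ≤ 17 / 10 * (2 ^ j * LLtwo j) := by linarith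
    _ ≤ 225 / 128 * (2 ^ j * LLtwo j) := by linarith
    _ = _ := by ring

lemma sum_truncLevel_le (n : ℕ) : ∑ j ∈ Finset.range n, truncLevel j ≤ 15 * truncLevel n := by
  induction n with
  | zero => simpa using (truncLevel_pos 0).le
  | succ n ih =>
    rw [Finset.sum_range_succ]
    linarith [truncLevel_le n]

/-- Geometric growth makes the sum comparable to its largest nonzero term, which is below `y`. -/
lemma sum_truncLevel_indicator_le (y : ℝ) (hy : 0 ≤ y) (n : ℕ) :
    ∑ j ∈ Finset.range n, (if truncLevel j < y then truncLevel j else 0) ≤ 16 * y := by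
  induction n with
  | zero => simpa using hy
  | succ n ih =>
    by_cases h : truncLevel n < y
    · calc ∑ j ∈ Finset.range (n + 1), (if truncLevel j < y then truncLevel j else 0)
          ≤ ∑ j ∈ Finset.range (n + 1), truncLevel j := by
            refine Finset.sum_le_sum fun j _ => ?_
            split_ifs
            exacts [le_rfl, (truncLevel_pos j).le]
        _ ≤ 16 * truncLevel n := by
            rw [Finset.sum_range_succ]
            linarith [sum_truncLevel_le n]
        _ ≤ 16 * y := by linarith
    · rw [Finset.sum_range_succ, if_neg h, add_zero]
      exact ih

/-- The elementary inequality behind the exponential supermartingale: a second-order bound for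
`x ↦ exp √(1 + ‖x‖²)` in an inner product space. -/
lemma exp_sqrt_one_add_norm_sq_le {H : Type*} [NormedAddCommGroup H] [InnerProductSpace ℝ H]
    (x D : H) (hD : ‖D‖ ≤ 1 / 2) :
    Real.exp √(1 + ‖x + D‖ ^ 2) ≤ Real.exp √(1 + ‖x‖ ^ 2) *
      (1 + inner ℝ ((√(1 + ‖x‖ ^ 2))⁻¹ • x) D + 3 * ‖D‖ ^ 2) := by
  set r := √(1 + ‖x‖ ^ 2) with hr
  set s := √(1 + ‖x + D‖ ^ 2) with hs
  have hr2 : r ^ 2 = 1 + ‖x‖ ^ 2 := Real.sq_sqrt (by positivity)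
  have hs2 : s ^ 2 = 1 + ‖x + D‖ ^ 2 := Real.sq_sqrt (by positivity)
  have hr1 : 1 ≤ r := Real.one_le_sqrt.2 (by nlinarith [sq_nonneg ‖x‖])
  have hr0 : 0 < r := by linarith
  have hxr : ‖x‖ ≤ r := Real.le_sqrt_of_sq_le (by linarith)
  set i := inner ℝ (r⁻¹ • x) D with hi
  have hi' : inner ℝ x D = r * i := by
    rw [hi, real_inner_smul_left]; field_simp
  have hiD : |i| ≤ ‖D‖ := by
    refine (abs_real_inner_le_norm _ _).trans ?_
    rw [norm_smul, norm_inv, Real.norm_of_nonneg hr0.le]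
    refine mul_le_of_le_one_left (norm_nonneg _) ?_
    rw [inv_mul_le_iff₀ hr0]; linarith
  have hexp : ‖x + D‖ ^ 2 = ‖x‖ ^ 2 + 2 * (r * i) + ‖D‖ ^ 2 := by
    rw [norm_add_sq_real, hi']
  set q := ‖D‖ ^ 2 / (2 * r) with hq
  have hq0 : 0 ≤ q := by positivity
  have hq1 : q ≤ ‖D‖ ^ 2 / 2 := by
    rw [hq]
    gcongr
    linarith
  have hqr : 2 * r * q = ‖D‖ ^ 2 := by rw [hq]; field_simp
  -- This is the tangent line bound for the square root, `s ≤ r + (s² - r²) / (2r)`.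
  have hsr : s ≤ r + (i + q) := by
    have h1 : s ^ 2 - r ^ 2 = 2 * r * (i + q) := by rw [hs2, hr2, hexp]; linarith
    have h2 : 0 ≤ (s - r) ^ 2 := sq_nonneg _
    have h3 : r * s ≤ r * (r + (i + q)) := by nlinarith
    exact le_of_mul_le_mul_left h3 hr0
  have hDn := norm_nonneg D
  have ht : |i + q| ≤ 5 / 4 * ‖D‖ := by
    refine (abs_add_le _ _).trans ?_
    rw [abs_of_nonneg hq0]
    nlinarith
  -- Here `|i + q| ≤ 1`, so `exp t ≤ 1 + t + t²` applies; the second-order terms total at most `(1/2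
  -- + 25/16) ‖D‖²`.
  have hexp' : Real.exp (i + q) ≤ 1 + i + 3 * ‖D‖ ^ 2 := by
    have h1 := Real.abs_exp_sub_one_sub_id_le (x := i + q) (by linarith)
    have h2 := (abs_le.1 h1).2
    have h3 : (i + q) ^ 2 ≤ (5 / 4 * ‖D‖) ^ 2 := sq_le_sq' (by linarith [(abs_le.1 ht).1])
      (abs_le.1 ht).2
    nlinarith
  calc Real.exp s ≤ Real.exp (r + (i + q)) := Real.exp_le_exp.2 hsr
    _ = Real.exp r * Real.exp (i + q) := Real.exp_add _ _
    _ ≤ _ := by gcongr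

end Scalar
-- Hopf's maximal ergodic theorem and the weak type inequality.
section MaximalErgodic

variable {Ω : Type u}

/-- The running maximum `max (0, S₁ g, …, S_n g)` of the Birkhoff sums. -/
noncomputable def birkhoffMax (θ : Ω → Ω) (g : Ω → ℝ) : ℕ → Ω → ℝ
  | 0, _ => 0
  | n + 1, ω => max 0 (g ω + birkhoffMax θ g n (θ ω))

lemma birkhoffMax_nonneg {θ : Ω → Ω} (g : Ω → ℝ) (n : ℕ) (ω : Ω) : 0 ≤ birkhoffMax θ g n ω := by
  cases n
  exacts [le_rfl, le_max_left _ _]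

lemma birkhoffMax_le_succ {θ : Ω → Ω} (g : Ω → ℝ) (n : ℕ) (ω : Ω) :
    birkhoffMax θ g n ω ≤ birkhoffMax θ g (n + 1) ω := by
  induction n generalizing ω with
  | zero => exact birkhoffMax_nonneg g _ ω
  | succ n ih => exact max_le_max_left _ (by gcongr; exact ih _)

lemma birkhoffSum_le_birkhoffMax {θ : Ω → Ω} (g : Ω → ℝ) (n : ℕ) (ω : Ω) :
    birkhoffSum θ g n ω ≤ birkhoffMax θ g n ω := by
  induction n generalizing ω with
  | zero => simp [birkhoffMax]
  | succ n ih =>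
    rw [birkhoffSum_succ']
    exact le_max_of_le_right (by gcongr; exact ih _)

variable [MeasurableSpace Ω] {μ : Measure Ω} {θ : Ω → Ω}

lemma integral_comp_of_measurePreserving {E : Type*} [NormedAddCommGroup E] [NormedSpace ℝ E]
    (hθ : MeasurePreserving θ μ μ) {f : Ω → E} (hf : AEStronglyMeasurable f μ) :
    ∫ ω, f (θ ω) ∂μ = ∫ ω, f ω ∂μ := by
  have h := integral_map hθ.aemeasurable (f := f) (by rwa [hθ.map_eq])
  rw [hθ.map_eq] at h
  exact h.symm

lemma integrable_birkhoffMax (hθ : MeasurePreserving θ μ μ) {g : Ω → ℝ} (hg : Integrable g μ)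
    (n : ℕ) : Integrable (birkhoffMax θ g n) μ := by
  induction n with
  | zero => exact integrable_zero _ _ _
  | succ n ih =>
    exact (integrable_zero _ _ _).sup (hg.add (hθ.integrable_comp_of_integrable ih))

lemma measurable_birkhoffMax (hθ : Measurable θ) {g : Ω → ℝ} (hg : Measurable g)
    (n : ℕ) : Measurable (birkhoffMax θ g n) := by
  induction n with
  | zero => exact measurable_const
  | succ n ih => exact measurable_const.max (hg.add (ih.comp hθ))

/-- Hopf's maximal ergodic theorem. -/
lemma setIntegral_birkhoffMax_pos_nonneg (hθ : MeasurePreserving θ μ μ) {g : Ω → ℝ}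
    (hgm : Measurable g) (hg : Integrable g μ) (n : ℕ) :
    0 ≤ ∫ ω in {ω | 0 < birkhoffMax θ g n ω}, g ω ∂μ := by
  set M := birkhoffMax θ g n with hM
  have hMi := integrable_birkhoffMax hθ hg n
  have hMθ : Integrable (fun ω => M (θ ω)) μ := hθ.integrable_comp_of_integrable hMi
  have hMm := measurable_birkhoffMax hθ.measurable hgm n
  have hs : MeasurableSet {ω | 0 < M ω} := measurableSet_lt measurable_const hMm
  -- Where `M > 0` the maximum in the recursion is its second entry, hence `g ≥ M - M ∘ θ`.
  -- Elsewhere `M = 0` and `M - M ∘ θ ≤ 0`, so restricting to `{M > 0}` only increases the integral,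
  -- which is zero over the whole space.
  have h1 : ∫ ω in {ω | 0 < M ω}, (M ω - M (θ ω)) ∂μ ≤ ∫ ω in {ω | 0 < M ω}, g ω ∂μ := by
    refine setIntegral_mono_on (hMi.sub hMθ).integrableOn hg.integrableOn hs fun ω hω => ?_
    have hω' : 0 < M ω := hω
    rcases n with _ | n
    · exact absurd hω' (lt_irrefl _)
    · have h2 : M ω = max 0 (g ω + birkhoffMax θ g n (θ ω)) := rfl
      have h3 : M ω = g ω + birkhoffMax θ g n (θ ω) := by
        rw [h2] at hω' ⊢
        exact max_eq_right ((lt_max_iff.1 hω').resolve_left (lt_irrefl _)).le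
      have h4 := birkhoffMax_le_succ (θ := θ) g n (θ ω)
      simp only [hM] at h3 ⊢
      linarith
  refine le_trans ?_ h1
  have h5 : ∫ ω, (M ω - M (θ ω)) ∂μ = 0 := by
    rw [integral_sub hMi hMθ, integral_comp_of_measurePreserving hθ hMi.1, sub_self]
  refine h5.symm.le.trans ?_
  rw [← integral_indicator hs]
  refine integral_mono (hMi.sub hMθ) ((hMi.sub hMθ).indicator hs) fun ω => ?_
  by_cases hω : 0 < M ω
  · rw [Set.indicator_of_mem (show ω ∈ {ω | 0 < M ω} from hω)]
  · rw [Set.indicator_of_notMem (show ω ∉ {ω | 0 < M ω} from hω)]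
    have := birkhoffMax_nonneg (θ := θ) g n (θ ω)
    simp only [hM] at hω ⊢
    linarith

/-- The weak type `(1, 1)` maximal ergodic inequality. -/
lemma measure_exists_birkhoffSum_gt_le [IsFiniteMeasure μ] (hθ : MeasurePreserving θ μ μ)
    {f : Ω → ℝ} (hfm : Measurable f) (hf : Integrable f μ) (hf0 : 0 ≤ f) {α : ℝ} (hα : 0 < α) :
    μ {ω | ∃ n : ℕ, α * n < birkhoffSum θ f n ω} ≤ ENNReal.ofReal ((∫ ω, f ω ∂μ) / α) := by
  -- The event says that some Birkhoff sum of `f - α` is positive, which Hopf's theorem controls.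
  set g : Ω → ℝ := fun ω => f ω - α with hg
  have hgi : Integrable g μ := hf.sub (integrable_const α)
  have hgm : Measurable g := hfm.sub_const α
  set s : ℕ → Set Ω := fun n => {ω | 0 < birkhoffMax θ g n ω} with hsdef
  have hs : ∀ n, MeasurableSet (s n) := fun n =>
    measurableSet_lt measurable_const (measurable_birkhoffMax hθ.measurable hgm n)
  have hmono : Monotone s := monotone_nat_of_le_succ fun n ω hω =>
    lt_of_lt_of_le hω (birkhoffMax_le_succ g n ω)
  have hsub : {ω | ∃ n : ℕ, α * n < birkhoffSum θ f n ω} ⊆ ⋃ n, s n := by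
    rintro ω ⟨n, hn⟩
    refine Set.mem_iUnion.2 ⟨n, lt_of_lt_of_le ?_ (birkhoffSum_le_birkhoffMax g n ω)⟩
    have : birkhoffSum θ g n ω = birkhoffSum θ f n ω - α * n := by
      simp [birkhoffSum, hg, Finset.sum_sub_distrib, mul_comm]
    linarith
  refine (measure_mono hsub).trans ?_
  rw [hmono.measure_iUnion]
  refine iSup_le fun n => ?_
  have h1 := setIntegral_birkhoffMax_pos_nonneg hθ hgm hgi n
  have h2 : ∫ ω in s n, g ω ∂μ = ∫ ω in s n, f ω ∂μ - α * μ.real (s n) := by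
    rw [hg, integral_sub hf.integrableOn (integrable_const α).integrableOn]
    simp [mul_comm]
  have h3 : ∫ ω in s n, f ω ∂μ ≤ ∫ ω, f ω ∂μ :=
    setIntegral_le_integral hf (Eventually.of_forall hf0)
  have h4 : μ.real (s n) ≤ (∫ ω, f ω ∂μ) / α := by
    rw [le_div_iff₀ hα]
    simp only [hsdef] at h2 h3 ⊢
    linarith
  rw [← ofReal_measureReal]
  exact ENNReal.ofReal_le_ofReal h4

end MaximalErgodic
-- Exponential supermartingale and Freedman inequality in reversed time.
section Exponential

variable {Ω : Type u} {H : Type v} [NormedAddCommGroup H]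

lemma norm_birkhoffSum_le_of_bound {θ : Ω → Ω} {D : Ω → H} {b : ℝ} (hb : ∀ ω, ‖D ω‖ ≤ b) (n : ℕ)
    (ω : Ω) : ‖birkhoffSum θ D n ω‖ ≤ n * b := by
  refine (norm_sum_le _ _).trans ((Finset.sum_le_sum fun _ _ => hb _).trans ?_)
  simp

lemma birkhoffSum_nonneg {θ : Ω → Ω} {f : Ω → ℝ} (hf : ∀ ω, 0 ≤ f ω) (n : ℕ) (ω : Ω) :
    0 ≤ birkhoffSum θ f n ω := Finset.sum_nonneg fun _ _ => hf _

variable [MeasurableSpace Ω] {μ : Measure Ω} {θ : Ω → Ω}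

lemma stronglyMeasurable_birkhoffSum (hθ : Measurable θ) {D : Ω → H} (hD : StronglyMeasurable D)
    (n : ℕ) : StronglyMeasurable (birkhoffSum θ D n) :=
  Finset.stronglyMeasurable_fun_sum _ fun k _ => hD.comp_measurable (hθ.iterate k)

variable [InnerProductSpace ℝ H]

/-- The exponential process attached to `D` and to a bound `w ∘ θ` for its conditional variance. -/
noncomputable def expMart (θ : Ω → Ω) (D : Ω → H) (w : Ω → ℝ) (l : ℝ) (n : ℕ) (ω : Ω) : ℝ :=
  Real.exp (√(1 + ‖l • birkhoffSum θ D n ω‖ ^ 2) - 3 * l ^ 2 * birkhoffSum θ (w ∘ θ) n ω)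

/-- A bounded strongly measurable `D` with `E (D | θ⁻¹ 𝓕) = 0` and
`E (‖D‖² | θ⁻¹ 𝓕) ≤ w ∘ θ`. -/
structure IsBoundedDiff (μ : Measure Ω) (θ : Ω → Ω) (D : Ω → H) (w : Ω → ℝ) (b : ℝ) : Prop where
  meas : StronglyMeasurable D
  bound : ∀ ω, ‖D ω‖ ≤ b
  measw : Measurable w
  nonneg : ∀ ω, 0 ≤ w ω
  integrable : Integrable w μ
  orth : ∀ (Y : Ω → H) (c : ℝ), StronglyMeasurable Y → (∀ ω, ‖Y ω‖ ≤ c) →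
    ∫ ω, inner ℝ (Y (θ ω)) (D ω) ∂μ = 0
  var : ∀ (z : Ω → ℝ) (c : ℝ), Measurable z → (∀ ω, 0 ≤ z ω) → (∀ ω, z ω ≤ c) →
    ∫ ω, z (θ ω) * ‖D ω‖ ^ 2 ∂μ ≤ ∫ ω, z ω * w ω ∂μ

namespace IsBoundedDiff

variable {D : Ω → H} {w : Ω → ℝ} {b l : ℝ}

lemma sqrt_one_add_le (h : IsBoundedDiff μ θ D w b) (hl : 0 ≤ l) (n : ℕ) (ω : Ω) :
    √(1 + ‖l • birkhoffSum θ D n ω‖ ^ 2) ≤ 1 + l * (n * b) := by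
  have h1 : ‖l • birkhoffSum θ D n ω‖ ≤ l * (n * b) := by
    rw [norm_smul, Real.norm_of_nonneg hl]
    gcongr
    exact norm_birkhoffSum_le_of_bound h.bound n ω
  have h2 := norm_nonneg (l • birkhoffSum θ D n ω)
  rw [Real.sqrt_le_left (by linarith)]
  nlinarith

lemma measurable_sqrt (hθ : Measurable θ) (h : IsBoundedDiff μ θ D w b) (l : ℝ) (n : ℕ) :
    Measurable fun ω => √(1 + ‖l • birkhoffSum θ D n ω‖ ^ 2) :=
  ((((stronglyMeasurable_birkhoffSum hθ h.meas n).const_smul l).norm.measurable.pow_const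
    2).const_add 1).sqrt

lemma measurable_expMart (hθ : Measurable θ) (h : IsBoundedDiff μ θ D w b) (l : ℝ) (n : ℕ) :
    Measurable (expMart θ D w l n) := by
  have h2 : Measurable (birkhoffSum θ (w ∘ θ) n) :=
    (stronglyMeasurable_birkhoffSum hθ (h.measw.comp hθ).stronglyMeasurable n).measurable
  exact Real.measurable_exp.comp ((h.measurable_sqrt hθ l n).sub (h2.const_mul _))

lemma expMart_le (h : IsBoundedDiff μ θ D w b) (hl : 0 ≤ l) (n : ℕ) (ω : Ω) :
    expMart θ D w l n ω ≤ Real.exp (1 + l * (n * b)) := by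
  refine Real.exp_le_exp.2 ?_
  have h1 := h.sqrt_one_add_le hl n ω
  have h2 : 0 ≤ birkhoffSum θ (w ∘ θ) n ω := birkhoffSum_nonneg (fun ω => h.nonneg _) n ω
  have : 0 ≤ 3 * l ^ 2 * birkhoffSum θ (w ∘ θ) n ω := by positivity
  linarith

lemma integrable_expMart [IsFiniteMeasure μ] (hθ : Measurable θ) (h : IsBoundedDiff μ θ D w b)
    (hl : 0 ≤ l) (n : ℕ) : Integrable (expMart θ D w l n) μ :=
  Integrable.of_bound (h.measurable_expMart hθ l n).aestronglyMeasurable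
    (Real.exp (1 + l * (n * b))) (Eventually.of_forall fun ω => by
      rw [expMart, Real.norm_of_nonneg (Real.exp_pos _).le]; exact h.expMart_le hl n ω)

/-- The supermartingale property of the exponential process. -/
lemma setIntegral_expMart_succ_le [IsFiniteMeasure μ] (hθ : MeasurePreserving θ μ μ)
    (h : IsBoundedDiff μ θ D w b) (hl : 0 ≤ l) (hlb : l * b ≤ 1 / 2) (n : ℕ) {B : Set Ω}
    (hB : MeasurableSet B) :
    ∫ ω in θ ⁻¹' B, expMart θ D w l (n + 1) ω ∂μ ≤ ∫ ω in B, expMart θ D w l n ω ∂μ := by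
  have hθm := hθ.measurable
  set S : Ω → H := fun ω => l • birkhoffSum θ D n ω with hS
  have hSm : StronglyMeasurable S := (stronglyMeasurable_birkhoffSum hθm h.meas n).const_smul l
  set r : Ω → ℝ := fun ω => √(1 + ‖S ω‖ ^ 2) with hr
  have hrm : Measurable r := h.measurable_sqrt hθm l n
  have hr1 : ∀ ω, 1 ≤ r ω := fun ω => Real.one_le_sqrt.2 (by nlinarith [sq_nonneg ‖S ω‖])
  set V : Ω → ℝ := birkhoffSum θ (w ∘ θ) n with hV
  have hVm : Measurable V :=
    (stronglyMeasurable_birkhoffSum hθm (h.measw.comp hθm).stronglyMeasurable n).measurable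
  have hV0 : ∀ ω, 0 ≤ V ω := birkhoffSum_nonneg (fun ω => h.nonneg _) n
  set c : ℝ := Real.exp (1 + l * (n * b)) with hc
  -- The compensator `w + V` is included in advance: composed with `θ` it is the full compensator at
  -- time `n + 1`. Thus `Z ∘ θ` is a function of `θ`, against which `D` can be tested.
  set Z : Ω → ℝ := B.indicator fun ω => Real.exp (r ω - 3 * l ^ 2 * (w ω + V ω)) with hZ
  have hZm : Measurable Z := (Real.measurable_exp.comp
    (hrm.sub ((h.measw.add hVm).const_mul _))).indicator hB
  have hZ0 : ∀ ω, 0 ≤ Z ω := fun ω => Set.indicator_nonneg (fun _ _ => (Real.exp_pos _).le) ω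
  have hZc : ∀ ω, Z ω ≤ c := fun ω => by
    refine Set.indicator_le' (g := fun _ => c) (fun ω _ => ?_)
      (fun _ _ => (Real.exp_pos _).le) ω
    refine Real.exp_le_exp.2 ?_
    have h1 : r ω ≤ _ := h.sqrt_one_add_le hl n ω
    have h2 := hV0 ω
    have h3 := h.nonneg ω
    have : 0 ≤ 3 * l ^ 2 * (w ω + V ω) := by positivity
    linarith
  set Y : Ω → H := fun ω => (Z ω * l) • ((r ω)⁻¹ • S ω) with hY
  have hYm : StronglyMeasurable Y :=
    (hZm.mul_const l).stronglyMeasurable.smul (hrm.inv.stronglyMeasurable.smul hSm)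
  have hYc : ∀ ω, ‖Y ω‖ ≤ c * l := fun ω => by
    have hx : ‖S ω‖ ≤ r ω := Real.le_sqrt_of_sq_le (by linarith)
    have hr0 : 0 < r ω := by linarith [hr1 ω]
    have h1 : ‖(r ω)⁻¹ • S ω‖ ≤ 1 := by
      rw [norm_smul, norm_inv, Real.norm_of_nonneg hr0.le, inv_mul_le_iff₀ hr0]
      linarith
    rw [hY, norm_smul, Real.norm_of_nonneg (mul_nonneg (hZ0 ω) hl)]
    calc _ ≤ c * l * 1 := by
          gcongr
          exact hZc ω
      _ = _ := mul_one _
  have hDint : Integrable (fun ω => Z (θ ω) * ‖D ω‖ ^ 2) μ := by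
    refine Integrable.of_bound ((hZm.comp hθm).mul
      (h.meas.norm.measurable.pow_const 2)).aestronglyMeasurable (c * b ^ 2)
      (Eventually.of_forall fun ω => ?_)
    have := hZ0 (θ ω)
    have := hZc (θ ω)
    have := h.bound ω
    rw [Real.norm_of_nonneg (by positivity)]
    gcongr
  have hZθ : Integrable (fun ω => Z (θ ω)) μ :=
    Integrable.of_bound (hZm.comp hθm).aestronglyMeasurable c (Eventually.of_forall fun ω => by
      rw [Real.norm_of_nonneg (hZ0 _)]; exact hZc _)
  have hZi : Integrable Z μ :=
    Integrable.of_bound hZm.aestronglyMeasurable c (Eventually.of_forall fun ω => by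
      rw [Real.norm_of_nonneg (hZ0 _)]; exact hZc _)
  have hYi : Integrable (fun ω => inner ℝ (Y (θ ω)) (D ω)) μ := by
    refine Integrable.of_bound ((hYm.comp_measurable hθm).inner h.meas).aestronglyMeasurable
      (c * l * b) (Eventually.of_forall fun ω => (norm_inner_le_norm _ _).trans ?_)
    have := hYc (θ ω)
    have := h.bound ω
    have := (norm_nonneg _).trans this
    gcongr
  have hZw : Integrable (fun ω => Z ω * w ω) μ :=
    h.integrable.bdd_mul hZm.aestronglyMeasurable (c := c) (Eventually.of_forall fun ω => by
      rw [Real.norm_of_nonneg (hZ0 _)]; exact hZc _)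
  rw [← integral_indicator (hθm hB), ← integral_indicator hB]
  calc ∫ ω, (θ ⁻¹' B).indicator (expMart θ D w l (n + 1)) ω ∂μ
      ≤ ∫ ω, (Z (θ ω) + inner ℝ (Y (θ ω)) (D ω) + 3 * l ^ 2 * (Z (θ ω) * ‖D ω‖ ^ 2)) ∂μ := by
        refine integral_mono ((h.integrable_expMart hθm hl (n + 1)).indicator (hθm hB))
          ((hZθ.add hYi).add (hDint.const_mul _)) fun ω => ?_
        by_cases hω : θ ω ∈ B
        · have hZe : Z (θ ω) = Real.exp (r (θ ω) - 3 * l ^ 2 * (w (θ ω) + V (θ ω))) :=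
            Set.indicator_of_mem hω _
          rw [Set.indicator_of_mem (show ω ∈ θ ⁻¹' B from hω)]
          have hD2 : ‖l • D ω‖ ≤ 1 / 2 := by
            rw [norm_smul, Real.norm_of_nonneg hl]
            exact (mul_le_mul_of_nonneg_left (h.bound ω) hl).trans hlb
          have key := exp_sqrt_one_add_norm_sq_le (S (θ ω)) (l • D ω) hD2
          have hSs : l • birkhoffSum θ D (n + 1) ω = S (θ ω) + l • D ω := by
            rw [birkhoffSum_succ', smul_add, add_comm]
          have hVs : birkhoffSum θ (w ∘ θ) (n + 1) ω = w (θ ω) + V (θ ω) := by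
            rw [birkhoffSum_succ']; rfl
          rw [expMart, hSs, hVs, Real.exp_sub]
          have h1 : inner ℝ (Y (θ ω)) (D ω)
              = Z (θ ω) * inner ℝ ((r (θ ω))⁻¹ • S (θ ω)) (l • D ω) := by
            rw [hY, real_inner_smul_left, real_inner_smul_right, mul_assoc]
          have h2 : ‖l • D ω‖ ^ 2 = l ^ 2 * ‖D ω‖ ^ 2 := by
            rw [norm_smul, mul_pow, Real.norm_eq_abs, sq_abs]
          rw [h1, div_le_iff₀ (Real.exp_pos _)]
          refine key.trans (le_of_eq ?_)
          have h3 : Real.exp (r (θ ω))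
              = Z (θ ω) * Real.exp (3 * l ^ 2 * (w (θ ω) + V (θ ω))) := by
            rw [hZe, ← Real.exp_add]; congr 1; ring
          change Real.exp (r (θ ω)) * _ = _
          rw [h3, h2]
          ring
        · rw [Set.indicator_of_notMem (show ω ∉ θ ⁻¹' B from hω)]
          have hZe : Z (θ ω) = 0 := Set.indicator_of_notMem hω _
          simp [hY, hZe]
    -- The first-order term vanishes because `D` is orthogonal to functions of `θ`.
    _ = ∫ ω, Z (θ ω) ∂μ + 3 * l ^ 2 * ∫ ω, Z (θ ω) * ‖D ω‖ ^ 2 ∂μ := by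
        have h1 := integral_add (hZθ.add hYi) (hDint.const_mul (3 * l ^ 2))
        simp only [Pi.add_apply] at h1
        rw [h1, integral_add hZθ hYi, h.orth Y _ hYm hYc, integral_const_mul, add_zero]
    _ ≤ ∫ ω, Z ω ∂μ + 3 * l ^ 2 * ∫ ω, Z ω * w ω ∂μ := by
        rw [integral_comp_of_measurePreserving hθ hZm.aestronglyMeasurable]
        exact add_le_add_right
          (mul_le_mul_of_nonneg_left (h.var Z c hZm hZ0 hZc) (by positivity)) _
    _ = ∫ ω, (Z ω + 3 * l ^ 2 * (Z ω * w ω)) ∂μ := by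
        rw [integral_add hZi (hZw.const_mul _), integral_const_mul]
    -- The factor `1 + u ≤ exp u` with `u = 3 * l ^ 2 * w` is absorbed by the part of the
    -- compensator anticipated in `Z`.
    _ ≤ _ := by
        refine integral_mono (hZi.add (hZw.const_mul _))
          ((h.integrable_expMart hθm hl n).indicator hB) fun ω => ?_
        by_cases hω : ω ∈ B
        · rw [Set.indicator_of_mem hω]
          have hZe : Z ω = Real.exp (r ω - 3 * l ^ 2 * (w ω + V ω)) :=
            Set.indicator_of_mem hω _
          have h1 := Real.add_one_le_exp (3 * l ^ 2 * w ω)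
          calc Z ω + 3 * l ^ 2 * (Z ω * w ω) = Z ω * (3 * l ^ 2 * w ω + 1) := by ring
            _ ≤ Z ω * Real.exp (3 * l ^ 2 * w ω) := by
              gcongr
              exact hZ0 ω
            _ = _ := by
              rw [hZe, ← Real.exp_add, expMart]
              congr 1
              simp only [hr, hS, hV]
              ring
        · rw [Set.indicator_of_notMem hω]
          have hZe : Z ω = 0 := Set.indicator_of_notMem hω _
          simp [hZe]

/-- The set on which the exponential process, read backwards from time `n`, exceeds `a`. -/
def exceedSet (θ : Ω → Ω) (D : Ω → H) (w : Ω → ℝ) (l a : ℝ) : ℕ → Set Ω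
  | 0 => {ω | a ≤ expMart θ D w l 0 ω}
  | n + 1 => θ ⁻¹' exceedSet θ D w l a n ∪ {ω | a ≤ expMart θ D w l (n + 1) ω}

omit [MeasurableSpace Ω] in
lemma mem_exceedSet {a : ℝ} {m n : ℕ} (hmn : m ≤ n) {ω : Ω}
    (h : a ≤ expMart θ D w l m (θ^[n - m] ω)) : ω ∈ exceedSet θ D w l a n := by
  induction n generalizing ω with
  | zero =>
    obtain rfl : m = 0 := by omega
    exact h
  | succ n ih =>
    rcases hmn.eq_or_lt with rfl | hlt
    · rw [Nat.sub_self] at h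
      exact Or.inr h
    · refine Or.inl (ih (by omega) ?_)
      rwa [← Function.iterate_succ_apply, show (n - m).succ = n + 1 - m by omega]

lemma measurableSet_exceedSet (hθ : Measurable θ) (h : IsBoundedDiff μ θ D w b) (l a : ℝ)
    (n : ℕ) : MeasurableSet (exceedSet θ D w l a n) := by
  induction n with
  | zero => exact measurableSet_le measurable_const (h.measurable_expMart hθ l 0)
  | succ n ih =>
    exact (hθ ih).union (measurableSet_le measurable_const (h.measurable_expMart hθ l (n + 1)))

/-- Optional stopping without stopping times. Passing from `n` to `n + 1`, the part already exceeded
is pulled back by `θ` with its measure preserved, the supermartingale step controls the rest, and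
the newly exceeding part carries mass at least `a` per unit of measure. The bound `exp 1` is the
initial value of the process. -/
lemma measure_exceedSet_add_le [IsProbabilityMeasure μ] (hθ : MeasurePreserving θ μ μ)
    (h : IsBoundedDiff μ θ D w b) (hl : 0 ≤ l) (hlb : l * b ≤ 1 / 2) (a : ℝ) (n : ℕ) :
    a * μ.real (exceedSet θ D w l a n) + ∫ ω in (exceedSet θ D w l a n)ᶜ, expMart θ D w l n ω ∂μ
      ≤ Real.exp 1 := by
  have hθm := hθ.measurable
  have hW := h.integrable_expMart hθm hl
  have hE : ∀ n, MeasurableSet {ω | a ≤ expMart θ D w l n ω} := fun n =>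
    measurableSet_le measurable_const (h.measurable_expMart hθm l n)
  induction n with
  | zero =>
    have hs := h.measurableSet_exceedSet hθm l a 0
    calc _ ≤ ∫ ω in exceedSet θ D w l a 0, expMart θ D w l 0 ω ∂μ
          + ∫ ω in (exceedSet θ D w l a 0)ᶜ, expMart θ D w l 0 ω ∂μ := by
          gcongr
          calc a * μ.real (exceedSet θ D w l a 0) = ∫ ω in exceedSet θ D w l a 0, a ∂μ := by
                simp [mul_comm]
            _ ≤ _ := setIntegral_mono_on (integrable_const a).integrableOn (hW 0).integrableOn hs
                fun ω hω => hω
      _ = ∫ ω, expMart θ D w l 0 ω ∂μ := integral_add_compl hs (hW 0)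
      _ ≤ _ := by simp [expMart]
  | succ n ih =>
    set A := exceedSet θ D w l a n with hA
    have hs : MeasurableSet A := h.measurableSet_exceedSet hθm l a n
    set C : Set Ω := {ω | a ≤ expMart θ D w l (n + 1) ω} with hC
    have hCm : MeasurableSet C := hE (n + 1)
    have hstep := h.setIntegral_expMart_succ_le hθ hl hlb n hs.compl
    have hsucc : exceedSet θ D w l a (n + 1) = θ ⁻¹' A ∪ (C ∩ θ ⁻¹' Aᶜ) := by
      rw [exceedSet]
      ext ω
      simp only [Set.mem_union, Set.mem_inter_iff, Set.mem_preimage, Set.mem_compl_iff, ← hA, ← hC]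
      tauto
    have hcompl : (exceedSet θ D w l a (n + 1))ᶜ = Cᶜ ∩ θ ⁻¹' Aᶜ := by
      rw [exceedSet]
      ext ω
      simp only [Set.mem_union, Set.mem_inter_iff, Set.mem_preimage, Set.mem_compl_iff, ← hA, ← hC]
      tauto
    have hdisj : Disjoint (θ ⁻¹' A) (C ∩ θ ⁻¹' Aᶜ) :=
      Set.disjoint_left.2 fun ω h1 h2 => h2.2 h1
    have h1 : a * μ.real (C ∩ θ ⁻¹' Aᶜ)
        ≤ ∫ ω in C ∩ θ ⁻¹' Aᶜ, expMart θ D w l (n + 1) ω ∂μ := by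
      calc a * μ.real (C ∩ θ ⁻¹' Aᶜ) = ∫ ω in C ∩ θ ⁻¹' Aᶜ, a ∂μ := by simp [mul_comm]
        _ ≤ _ := setIntegral_mono_on (integrable_const a).integrableOn (hW _).integrableOn
            (hCm.inter (hθm hs.compl)) fun ω hω => hω.1
    have h2 : ∫ ω in θ ⁻¹' Aᶜ, expMart θ D w l (n + 1) ω ∂μ
        = ∫ ω in C ∩ θ ⁻¹' Aᶜ, expMart θ D w l (n + 1) ω ∂μ
          + ∫ ω in Cᶜ ∩ θ ⁻¹' Aᶜ, expMart θ D w l (n + 1) ω ∂μ := by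
      rw [Set.inter_comm C, Set.inter_comm Cᶜ, ← Set.sdiff_eq]
      exact (integral_inter_add_sdiff hCm (hW _).integrableOn).symm
    rw [hcompl, hsucc, measureReal_union hdisj (hCm.inter (hθm hs.compl)),
      hθ.measureReal_preimage hs.nullMeasurableSet]
    linarith

/-- Ville's inequality for the exponential process. -/
lemma measure_exceedSet_le [IsProbabilityMeasure μ] (hθ : MeasurePreserving θ μ μ)
    (h : IsBoundedDiff μ θ D w b) (hl : 0 ≤ l) (hlb : l * b ≤ 1 / 2) (y : ℝ) (n : ℕ) :
    μ (exceedSet θ D w l (Real.exp y) n) ≤ ENNReal.ofReal (Real.exp (1 - y)) := by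
  have h1 := h.measure_exceedSet_add_le hθ hl hlb (Real.exp y) n
  have h2 : 0 ≤ ∫ ω in (exceedSet θ D w l (Real.exp y) n)ᶜ, expMart θ D w l n ω ∂μ :=
    integral_nonneg fun ω => (Real.exp_pos _).le
  rw [← ofReal_measureReal]
  refine ENNReal.ofReal_le_ofReal ?_
  rw [Real.exp_sub, le_div_iff₀ (Real.exp_pos _)]
  linarith

/-- A Freedman type inequality for the partial maxima of `‖S_n(D)‖`. -/
lemma measure_exists_norm_gt_le [IsProbabilityMeasure μ] (hθ : MeasurePreserving θ μ μ)
    (h : IsBoundedDiff μ θ D w b) (hl : 0 ≤ l) (hlb : l * b ≤ 1 / 2) (x s : ℝ) (N : ℕ) :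
    μ {ω | birkhoffSum θ (w ∘ θ) N ω ≤ s ∧ ∃ n ≤ N, 2 * x < ‖birkhoffSum θ D n ω‖}
      ≤ ENNReal.ofReal (Real.exp (1 - (l * x - 3 * l ^ 2 * s))) := by
  refine (measure_mono ?_).trans (h.measure_exceedSet_le hθ hl hlb _ N)
  rintro ω ⟨hs, n, hn, hx⟩
  -- Only sums over final blocks `[N - m, N)` are martingale values in reversed time. An initial sum
  -- is a difference of two such sums, so one of them is at least `x` when it exceeds `2 * x`.
  have key : ∀ m ≤ N, x ≤ ‖birkhoffSum θ D m (θ^[N - m] ω)‖ →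
      ω ∈ exceedSet θ D w l (Real.exp (l * x - 3 * l ^ 2 * s)) N := by
    intro m hm hxm
    refine mem_exceedSet hm (Real.exp_le_exp.2 ?_)
    have h1 : birkhoffSum θ (w ∘ θ) m (θ^[N - m] ω) ≤ s := by
      have h2 := birkhoffSum_add θ (w ∘ θ) (N - m) m ω
      rw [Nat.sub_add_cancel hm] at h2
      have h3 : 0 ≤ birkhoffSum θ (w ∘ θ) (N - m) ω := birkhoffSum_nonneg (fun ω => h.nonneg _) _ ω
      linarith
    have h2 : l * x ≤ √(1 + ‖l • birkhoffSum θ D m (θ^[N - m] ω)‖ ^ 2) := by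
      calc l * x ≤ ‖l • birkhoffSum θ D m (θ^[N - m] ω)‖ := by
            rw [norm_smul, Real.norm_of_nonneg hl]; gcongr
        _ ≤ _ := Real.le_sqrt_of_sq_le (by linarith)
    have h3 : 3 * l ^ 2 * birkhoffSum θ (w ∘ θ) m (θ^[N - m] ω) ≤ 3 * l ^ 2 * s := by gcongr
    linarith
  have h4 := birkhoffSum_add θ D n (N - n) ω
  rw [Nat.add_sub_cancel' hn] at h4
  by_cases hN : x ≤ ‖birkhoffSum θ D N ω‖
  · exact key N le_rfl (by simpa using hN)
  · refine key (N - n) (Nat.sub_le _ _) ?_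
    rw [show N - (N - n) = n by omega]
    have h5 : birkhoffSum θ D n ω = birkhoffSum θ D N ω - birkhoffSum θ D (N - n) (θ^[n] ω) := by
      rw [h4, add_sub_cancel_right]
    have h6 := norm_sub_le (birkhoffSum θ D N ω) (birkhoffSum θ D (N - n) (θ^[n] ω))
    rw [← h5] at h6
    linarith

end IsBoundedDiff
end Exponential
-- Conditional expectation along the map, and truncation of differences.
section Truncation

variable {Ω : Type u} [MeasurableSpace Ω] {μ : Measure Ω} {θ : Ω → Ω}

/-- The density of the image under `θ` of a finite measure with density `f`; it represents the
conditional expectation of `f` given `θ⁻¹ 𝓕`. -/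
lemma exists_transfer_density [IsFiniteMeasure μ] (hθ : MeasurePreserving θ μ μ) {f : Ω → ℝ}
    (hfm : Measurable f) (hf0 : ∀ ω, 0 ≤ f ω) (hf : Integrable f μ) :
    ∃ w : Ω → ℝ, Measurable w ∧ (∀ ω, 0 ≤ w ω) ∧ Integrable w μ ∧
      ∀ z : Ω → ℝ, Measurable z → ∫ ω, z (θ ω) * f ω ∂μ = ∫ ω, z ω * w ω ∂μ := by
  set ρ : Measure Ω := μ.withDensity fun ω => ENNReal.ofReal (f ω) with hρ
  have : IsFiniteMeasure ρ := isFiniteMeasure_withDensity_ofReal hf.2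
  set ν : Measure Ω := ρ.map θ with hν
  have hac : ν ≪ μ := by
    have h := (withDensity_absolutelyContinuous μ fun ω => ENNReal.ofReal (f ω)).map hθ.measurable
    rwa [hθ.map_eq] at h
  refine ⟨fun ω => (ν.rnDeriv μ ω).toReal, (Measure.measurable_rnDeriv ν μ).ennreal_toReal,
    fun ω => ENNReal.toReal_nonneg, Measure.integrable_toReal_rnDeriv, fun z hz => ?_⟩
  have h1 := integral_rnDeriv_smul (f := z) hac
  have h2 : ∫ ω, z ω ∂ν = ∫ ω, z (θ ω) ∂ρ :=
    integral_map hθ.measurable.aemeasurable hz.aestronglyMeasurable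
  have h3 : ∫ ω, z (θ ω) ∂ρ = ∫ ω, (ENNReal.ofReal (f ω)).toReal • z (θ ω) ∂μ :=
    integral_withDensity_eq_integral_toReal_smul hfm.ennreal_ofReal
      (Eventually.of_forall fun _ => ENNReal.ofReal_lt_top) _
  simp only [smul_eq_mul] at h1 h3
  calc ∫ ω, z (θ ω) * f ω ∂μ = ∫ ω, (ENNReal.ofReal (f ω)).toReal * z (θ ω) ∂μ := by
        refine integral_congr_ae (Eventually.of_forall fun ω => ?_)
        simp only [ENNReal.toReal_ofReal (hf0 ω), mul_comm]
    _ = _ := by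
        rw [← h3, ← h2, ← h1]
        simp only [mul_comm]

variable {H : Type v} [NormedAddCommGroup H] [InnerProductSpace ℝ H]

/-- `g ∘ θ` is the conditional expectation of `X` given `θ⁻¹ 𝓕`, in weak form. -/
def IsTransfer (μ : Measure Ω) (θ : Ω → Ω) (X g : Ω → H) : Prop :=
  ∀ Y : Ω → H, MemLp Y 2 μ → ∫ ω, inner ℝ (Y (θ ω)) (X ω) ∂μ = ∫ ω, inner ℝ (Y ω) (g ω) ∂μ

lemma exists_isTransfer [CompleteSpace H] (hθ : MeasurePreserving θ μ μ) {X : Ω → H}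
    (hX : MemLp X 2 μ) : ∃ g : Ω → H, StronglyMeasurable g ∧ MemLp g 2 μ ∧ IsTransfer μ θ X g := by
  refine ⟨perronFrobenius hθ (hX.toLp X), Lp.stronglyMeasurable _, Lp.memLp _, fun Y hY => ?_⟩
  have h := integral_perronFrobenius hθ (hX.toLp X) (hY.toLp Y)
  have h1 : ∫ ω, inner ℝ (hX.toLp X ω) (hY.toLp Y (θ ω)) ∂μ
      = ∫ ω, inner ℝ (Y (θ ω)) (X ω) ∂μ := by
    refine integral_congr_ae ?_
    filter_upwards [hX.coeFn_toLp, hθ.quasiMeasurePreserving.ae hY.coeFn_toLp] with ω h1 h2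
    rw [h1, h2, real_inner_comm]
  rw [← h1, h]
  refine integral_congr_ae ?_
  filter_upwards [hY.coeFn_toLp] with ω h2
  rw [h2, real_inner_comm]

/-- Conditional expectation contracts the `L¹` norm: test the duality against the unit field `g /
‖g‖` cut off to `B`. -/
lemma IsTransfer.setIntegral_norm_le [IsFiniteMeasure μ] (hθ : MeasurePreserving θ μ μ)
    {X g : Ω → H} (h : IsTransfer μ θ X g) (hX : Integrable X μ) (hg : StronglyMeasurable g)
    {B : Set Ω} (hB : MeasurableSet B) :
    ∫ ω in B, ‖g ω‖ ∂μ ≤ ∫ ω in θ ⁻¹' B, ‖X ω‖ ∂μ := by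
  set Y : Ω → H := B.indicator fun ω => ‖g ω‖⁻¹ • g ω with hY
  have hYm : StronglyMeasurable Y :=
    (hg.norm.measurable.inv.stronglyMeasurable.smul hg).indicator hB
  have hY1 : ∀ ω, ‖Y ω‖ ≤ 1 := fun ω => by
    by_cases hω : ω ∈ B
    · rw [hY, Set.indicator_of_mem hω, norm_smul, norm_inv, norm_norm]
      exact inv_mul_le_one
    · rw [hY, Set.indicator_of_notMem hω]; simp
  have hYL : MemLp Y 2 μ := MemLp.of_bound hYm.aestronglyMeasurable 1 (Eventually.of_forall hY1)
  rw [← integral_indicator hB, ← integral_indicator (hθ.measurable hB)]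
  calc ∫ ω, B.indicator (fun ω => ‖g ω‖) ω ∂μ = ∫ ω, inner ℝ (Y ω) (g ω) ∂μ := by
        refine integral_congr_ae (Eventually.of_forall fun ω => ?_)
        by_cases hω : ω ∈ B
        · simp only [hY, Set.indicator_of_mem hω, real_inner_smul_left,
            real_inner_self_eq_norm_sq]
          by_cases h0 : ‖g ω‖ = 0
          · simp [h0]
          · field_simp
        · simp [hY, Set.indicator_of_notMem hω]
    _ = ∫ ω, inner ℝ (Y (θ ω)) (X ω) ∂μ := (h Y hYL).symm
    _ ≤ _ := by
        refine (Real.le_norm_self _).trans (norm_integral_le_of_norm_le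
          (hX.norm.indicator (hθ.measurable hB)) (Eventually.of_forall fun ω => ?_))
        refine (norm_inner_le_norm _ _).trans ?_
        by_cases hω : θ ω ∈ B
        · rw [Set.indicator_of_mem (show ω ∈ θ ⁻¹' B from hω)]
          exact mul_le_of_le_one_left (norm_nonneg _) (hY1 _)
        · rw [hY, Set.indicator_of_notMem hω, norm_zero, zero_mul]
          exact Set.indicator_nonneg (fun _ _ => norm_nonneg _) ω

lemma IsTransfer.congr_right {X g g' : Ω → H} (h : IsTransfer μ θ X g) (hg : g =ᵐ[μ] g') :
    IsTransfer μ θ X g' := fun Y hY => by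
  rw [h Y hY]
  refine integral_congr_ae ?_
  filter_upwards [hg] with ω hω
  rw [hω]

lemma IsTransfer.norm_le [IsFiniteMeasure μ] (hθ : MeasurePreserving θ μ μ)
    {X g : Ω → H} (h : IsTransfer μ θ X g) (hX : Integrable X μ) (hg : StronglyMeasurable g)
    (hgi : Integrable g μ) {b : ℝ} (hb : ∀ ω, ‖X ω‖ ≤ b) : ∀ᵐ ω ∂μ, ‖g ω‖ ≤ b := by
  refine ae_le_of_forall_setIntegral_le hgi.norm (integrable_const b) fun B hB _ => ?_
  refine (h.setIntegral_norm_le hθ hX hg hB).trans ?_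
  calc ∫ ω in θ ⁻¹' B, ‖X ω‖ ∂μ ≤ ∫ ω in θ ⁻¹' B, b ∂μ :=
        setIntegral_mono hX.norm.integrableOn (integrable_const b).integrableOn hb
    _ = _ := by simp [hθ.measureReal_preimage hB.nullMeasurableSet]

/-- A square integrable `d` with `E (d | θ⁻¹ 𝓕) = 0`, in weak form. -/
structure IsReverseDiff (μ : Measure Ω) (θ : Ω → Ω) (d : Ω → H) : Prop where
  memLp : MemLp d 2 μ
  orth : ∀ Y : Ω → H, MemLp Y 2 μ → ∫ ω, inner ℝ (Y (θ ω)) (d ω) ∂μ = 0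

lemma integrable_inner_of_memLp {X Y : Ω → H} (hX : MemLp X 2 μ) (hY : MemLp Y 2 μ) :
    Integrable (fun ω => inner ℝ (X ω) (Y ω)) μ := by
  refine (L2.integrable_inner (𝕜 := ℝ) (hX.toLp X) (hY.toLp Y)).congr ?_
  filter_upwards [hX.coeFn_toLp, hY.coeFn_toLp] with ω h1 h2
  rw [h1, h2]

/-- Cut `d` at height `b` into `t + e` and subtract from `t` its conditional expectation `g ∘ θ`.
Recentring does not increase the conditional second moment. As `d` is centred, the conditional
expectation of `e` is `-g ∘ θ`, so the remainder `e + g ∘ θ` costs at most twice the `L¹` norm of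
`e`. -/
lemma exists_truncation [IsFiniteMeasure μ] [CompleteSpace H] (hθ : MeasurePreserving θ μ μ)
    {d : Ω → H} (hdm : StronglyMeasurable d) (hd : IsReverseDiff μ θ d) {w : Ω → ℝ}
    (hwm : Measurable w) (hw0 : ∀ ω, 0 ≤ w ω) (hwi : Integrable w μ)
    (hw : ∀ z : Ω → ℝ, Measurable z → ∫ ω, z (θ ω) * ‖d ω‖ ^ 2 ∂μ = ∫ ω, z ω * w ω ∂μ)
    {b : ℝ} (hb : 0 ≤ b) :
    ∃ D E : Ω → H, (∀ ω, d ω = D ω + E ω) ∧ IsBoundedDiff μ θ D w (2 * b) ∧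
      StronglyMeasurable E ∧ Integrable E μ ∧
      ∫ ω, ‖E ω‖ ∂μ ≤ 2 * ∫ ω, {ω | b < ‖d ω‖}.indicator (fun ω => ‖d ω‖) ω ∂μ := by
  have hθm := hθ.measurable
  have hdi : Integrable d μ := hd.memLp.integrable one_le_two
  set B : Set Ω := {ω | b < ‖d ω‖} with hB
  have hBm : MeasurableSet B := measurableSet_lt measurable_const hdm.norm.measurable
  set e : Ω → H := B.indicator d with he
  set t : Ω → H := Bᶜ.indicator d with ht
  have hem : StronglyMeasurable e := hdm.indicator hBm
  have htm : StronglyMeasurable t := hdm.indicator hBm.compl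
  have hsum : ∀ ω, d ω = t ω + e ω := fun ω => by
    rw [add_comm]; exact (congrFun (Set.indicator_self_add_compl B d) ω).symm
  have htb : ∀ ω, ‖t ω‖ ≤ b := fun ω => by
    by_cases hω : ω ∈ B
    · rw [ht, Set.indicator_of_notMem (by simpa using hω)]; simpa using hb
    · rw [ht, Set.indicator_of_mem (by simpa using hω)]; exact not_lt.1 hω
  have htd : ∀ ω, ‖t ω‖ ≤ ‖d ω‖ := fun ω => norm_indicator_le_norm_self _ _
  have hte : ∀ ω, ‖e ω‖ = B.indicator (fun ω => ‖d ω‖) ω := fun ω =>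
    norm_indicator_eq_indicator_norm _ _
  have htL : MemLp t 2 μ := hd.memLp.indicator hBm.compl
  have heL : MemLp e 2 μ := hd.memLp.indicator hBm
  obtain ⟨g₀, hg₀m, hg₀L, hg₀⟩ := exists_isTransfer hθ htL
  have hg₀b := hg₀.norm_le hθ (htL.integrable one_le_two) hg₀m (hg₀L.integrable one_le_two) htb
  -- The bound on `g₀` holds only almost everywhere; cutting off on `C` makes it hold everywhere, as
  -- `IsBoundedDiff` demands.
  set C : Set Ω := {ω | ‖g₀ ω‖ ≤ b} with hC
  have hCm : MeasurableSet C := measurableSet_le hg₀m.norm.measurable measurable_const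
  set g : Ω → H := C.indicator g₀ with hgdef
  have hgm : StronglyMeasurable g := hg₀m.indicator hCm
  have hgL : MemLp g 2 μ := hg₀L.indicator hCm
  have hgg : g₀ =ᵐ[μ] g := by
    filter_upwards [hg₀b] with ω hω
    rw [hgdef, Set.indicator_of_mem (show ω ∈ C from hω)]
  have hgb : ∀ ω, ‖g ω‖ ≤ b := fun ω => by
    by_cases hω : ω ∈ C
    · rw [hgdef, Set.indicator_of_mem hω]; exact hω
    · rw [hgdef, Set.indicator_of_notMem hω]; simpa using hb
  have hg : IsTransfer μ θ t g := hg₀.congr_right hgg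
  have hge : IsTransfer μ θ e (-g) := fun Y hY => by
    have hYθ : MemLp (fun ω => Y (θ ω)) 2 μ := hY.comp_measurePreserving hθ
    have h1 := hd.orth Y hY
    have h2 : ∫ ω, inner ℝ (Y (θ ω)) (d ω) ∂μ
        = ∫ ω, inner ℝ (Y (θ ω)) (t ω) ∂μ + ∫ ω, inner ℝ (Y (θ ω)) (e ω) ∂μ := by
      rw [← integral_add (integrable_inner_of_memLp hYθ htL) (integrable_inner_of_memLp hYθ heL)]
      simp only [hsum, inner_add_right]
    have h3 := hg Y hY
    simp only [Pi.neg_apply, inner_neg_right, integral_neg]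
    linarith
  have hgθm : StronglyMeasurable fun ω => g (θ ω) := hgm.comp_measurable hθm
  have hgθL : MemLp (fun ω => g (θ ω)) 2 μ := hgL.comp_measurePreserving hθ
  have hei : Integrable e μ := heL.integrable one_le_two
  have hgi : Integrable (fun ω => g (θ ω)) μ := hgθL.integrable one_le_two
  refine ⟨fun ω => t ω - g (θ ω), fun ω => e ω + g (θ ω), fun ω => ?_,
    ⟨htm.sub hgθm, fun ω => ?_, hwm, hw0, hwi, fun Y c hY hYc => ?_, fun z c hz hz0 hzc => ?_⟩,
    hem.add hgθm, hei.add hgi, ?_⟩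
  · rw [hsum]; exact (sub_add_add_cancel _ _ _).symm
  · refine (norm_sub_le _ _).trans ?_
    have := htb ω
    have := hgb (θ ω)
    linarith
  · have hYL : MemLp Y 2 μ := MemLp.of_bound hY.aestronglyMeasurable c (Eventually.of_forall hYc)
    have hYθ : MemLp (fun ω => Y (θ ω)) 2 μ := hYL.comp_measurePreserving hθ
    simp only [inner_sub_right]
    rw [integral_sub (integrable_inner_of_memLp hYθ htL) (integrable_inner_of_memLp hYθ hgθL),
      hg Y hYL, sub_eq_zero]
    exact (integral_comp_of_measurePreserving hθ (hY.inner hgm).aestronglyMeasurable).symm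
  · set Y : Ω → H := fun ω => z ω • g ω with hY
    have hzn : ∀ ω, ‖z ω‖ ≤ c := fun ω => by rw [Real.norm_of_nonneg (hz0 ω)]; exact hzc ω
    have hYL : MemLp Y 2 μ := by
      refine MemLp.of_bound (hz.stronglyMeasurable.smul hgm).aestronglyMeasurable (c * b)
        (Eventually.of_forall fun ω => ?_)
      rw [hY, norm_smul]
      have := (hz0 ω).trans (hzc ω)
      exact mul_le_mul (hzn ω) (hgb ω) (norm_nonneg _) this
    have hYθ : MemLp (fun ω => Y (θ ω)) 2 μ := hYL.comp_measurePreserving hθ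
    have i1 : Integrable (fun ω => z (θ ω) * ‖d ω‖ ^ 2) μ :=
      (hd.memLp.integrable_norm_pow two_ne_zero).bdd_mul (hz.comp hθm).aestronglyMeasurable
        (c := c) (Eventually.of_forall fun ω => hzn _)
    have i2 := integrable_inner_of_memLp hYθ htL
    have i3 := integrable_inner_of_memLp hYθ hgθL
    have h1 : ∫ ω, inner ℝ (Y (θ ω)) (g (θ ω)) ∂μ = ∫ ω, inner ℝ (Y (θ ω)) (t ω) ∂μ := by
      rw [hg Y hYL]
      exact integral_comp_of_measurePreserving hθ
        (f := fun ω => inner ℝ (Y ω) (g ω))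
        ((hz.stronglyMeasurable.smul hgm).inner hgm).aestronglyMeasurable
    have h2 : 0 ≤ ∫ ω, inner ℝ (Y (θ ω)) (g (θ ω)) ∂μ := integral_nonneg fun ω => by
      simp only [hY, real_inner_smul_left]
      exact mul_nonneg (hz0 _) real_inner_self_nonneg
    rw [← hw z hz]
    calc ∫ ω, z (θ ω) * ‖t ω - g (θ ω)‖ ^ 2 ∂μ
        ≤ ∫ ω, (z (θ ω) * ‖d ω‖ ^ 2 - 2 * inner ℝ (Y (θ ω)) (t ω)
            + inner ℝ (Y (θ ω)) (g (θ ω))) ∂μ := by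
          refine integral_mono_of_nonneg (Eventually.of_forall fun ω => ?_)
            ((i1.sub (i2.const_mul 2)).add i3) (Eventually.of_forall fun ω => ?_)
          · exact mul_nonneg (hz0 _) (sq_nonneg _)
          · have h3 : ‖t ω‖ ^ 2 ≤ ‖d ω‖ ^ 2 := by gcongr; exact htd ω
            have h4 := hz0 (θ ω)
            simp only [hY, real_inner_smul_left, real_inner_self_eq_norm_sq]
            rw [norm_sub_sq_real, real_inner_comm]
            nlinarith
      _ = ∫ ω, z (θ ω) * ‖d ω‖ ^ 2 ∂μ - 2 * ∫ ω, inner ℝ (Y (θ ω)) (t ω) ∂μ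
            + ∫ ω, inner ℝ (Y (θ ω)) (g (θ ω)) ∂μ := by
          have h3 := integral_add (i1.sub (i2.const_mul 2)) i3
          simp only [Pi.sub_apply] at h3
          rw [h3, integral_sub i1 (i2.const_mul 2), integral_const_mul]
      _ ≤ _ := by linarith
  · have h1 := hge.setIntegral_norm_le hθ hei hgm.neg MeasurableSet.univ
    simp only [Set.preimage_univ, Measure.restrict_univ, Pi.neg_apply, norm_neg] at h1
    have h2 : ∫ ω, ‖g (θ ω)‖ ∂μ = ∫ ω, ‖g ω‖ ∂μ :=
      integral_comp_of_measurePreserving hθ hgm.norm.aestronglyMeasurable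
    calc ∫ ω, ‖e ω + g (θ ω)‖ ∂μ ≤ ∫ ω, (‖e ω‖ + ‖g (θ ω)‖) ∂μ :=
          integral_mono (hei.add hgi).norm (hei.norm.add hgi.norm) fun ω => norm_add_le _ _
      _ = ∫ ω, ‖e ω‖ ∂μ + ∫ ω, ‖g (θ ω)‖ ∂μ := integral_add hei.norm hgi.norm
      _ ≤ 2 * ∫ ω, ‖e ω‖ ∂μ := by linarith
      _ = _ := by simp only [hte]

end Truncation
-- Tail estimate for the maximal function of a reverse martingale difference.
section Tail

variable {Ω : Type u} {H : Type v} [NormedAddCommGroup H] {θ : Ω → Ω}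

lemma lt_maximalFunction_iff {X : Ω → H} {ω : Ω} {c : ℝ} (hc : 0 ≤ c) :
    ENNReal.ofReal c < maximalFunction θ X ω ↔
      ∃ n : ℕ, 1 ≤ n ∧ c * lilNorm n < ‖birkhoffSum θ X n ω‖ := by
  simp only [maximalFunction, lt_iSup_iff, exists_prop]
  refine exists_congr fun n => and_congr_right fun hn => ?_
  have h := lilNorm_pos hn
  rw [← ofReal_norm, ← ENNReal.ofReal_div_of_pos h, ENNReal.ofReal_lt_ofReal_iff_of_nonneg hc,
    lt_div_iff₀ h]

variable [MeasurableSpace Ω] {μ : Measure Ω} [InnerProductSpace ℝ H] [CompleteSpace H]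

/-- The constant in the exponential part of the tail estimate. -/
noncomputable def tailConst : ℝ := Real.exp (7 / 2) * (1 + ∑' j, Real.exp (-(2 * LLtwo j)))

lemma one_le_tsum_exp : 1 ≤ 1 + ∑' j, Real.exp (-(2 * LLtwo j)) :=
  le_add_of_nonneg_right (tsum_nonneg fun _ => (Real.exp_pos _).le)

lemma tailConst_pos : 0 < tailConst :=
  mul_pos (Real.exp_pos _) (zero_lt_one.trans_le one_le_tsum_exp)

variable [IsProbabilityMeasure μ]

omit [InnerProductSpace ℝ H] [CompleteSpace H] in
lemma measure_sum_norm_gt_le (hθ : MeasurePreserving θ μ μ) {E : Ω → H}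
    (hE : StronglyMeasurable E) (hEi : Integrable E μ) (N : ℕ) {x : ℝ} (hx : 0 < x) :
    μ {ω | x < birkhoffSum θ (fun ω => ‖E ω‖) N ω} ≤
      ENNReal.ofReal (N * (∫ ω, ‖E ω‖ ∂μ) / x) := by
  have hint : ∀ k, Integrable (fun ω => ‖E (θ^[k] ω)‖) μ := fun k =>
    ((hθ.iterate k).integrable_comp_of_integrable hEi).norm
  have h0 : ∀ ω, 0 ≤ birkhoffSum θ (fun ω => ‖E ω‖) N ω :=
    birkhoffSum_nonneg (fun _ => norm_nonneg _) N
  have hi : Integrable (birkhoffSum θ (fun ω => ‖E ω‖) N) μ :=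
    integrable_finsetSum _ fun k _ => hint k
  have h1 : ∫ ω, birkhoffSum θ (fun ω => ‖E ω‖) N ω ∂μ = N * ∫ ω, ‖E ω‖ ∂μ := by
    simp only [birkhoffSum]
    rw [integral_finsetSum _ fun k _ => hint k]
    simp only [integral_comp_of_measurePreserving (hθ.iterate _) hE.norm.aestronglyMeasurable]
    simp
  have h2 := mul_meas_ge_le_integral_of_nonneg (Eventually.of_forall h0) hi x
  rw [h1] at h2
  refine (measure_mono (t := {ω | x ≤ birkhoffSum θ (fun ω => ‖E ω‖) N ω})
    fun ω (hω : x < _) => hω.le).trans ?_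
  rw [← ofReal_measureReal]
  refine ENNReal.ofReal_le_ofReal ?_
  rw [le_div_iff₀ hx, mul_comm]
  exact h2

-- Exchanging sum and integral leaves the truncation levels below `‖d‖ / A`, whose sum is at most
-- `16 * ‖d‖ / A`. This makes the Markov bounds over all dyadic blocks summable.
omit [InnerProductSpace ℝ H] [CompleteSpace H] in
lemma sum_truncLevel_mul_integral_le {d : Ω → H} (hdm : StronglyMeasurable d) (hd : MemLp d 2 μ)
    {A : ℝ} (hA : 0 < A) (n : ℕ) :
    ∑ j ∈ Finset.range n, truncLevel j *
        ∫ ω, {ω | A * truncLevel j < ‖d ω‖}.indicator (fun ω => ‖d ω‖) ω ∂μ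
      ≤ 16 / A * ∫ ω, ‖d ω‖ ^ 2 ∂μ := by
  have hdi : Integrable d μ := hd.integrable one_le_two
  have hs : ∀ j, MeasurableSet {ω | A * truncLevel j < ‖d ω‖} := fun j =>
    measurableSet_lt measurable_const hdm.norm.measurable
  simp only [← integral_const_mul]
  rw [← integral_finsetSum _ fun j _ => (hdi.norm.indicator (hs j)).const_mul _]
  refine integral_mono (integrable_finsetSum _ fun j _ => (hdi.norm.indicator (hs j)).const_mul _)
    ((hd.integrable_norm_pow two_ne_zero).const_mul _) fun ω => ?_
  have h := sum_truncLevel_indicator_le (‖d ω‖ / A) (by positivity) n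
  calc ∑ j ∈ Finset.range n, truncLevel j *
        {ω | A * truncLevel j < ‖d ω‖}.indicator (fun ω => ‖d ω‖) ω
      = (∑ j ∈ Finset.range n, if truncLevel j < ‖d ω‖ / A then truncLevel j else 0) * ‖d ω‖ := by
        rw [Finset.sum_mul]
        refine Finset.sum_congr rfl fun j _ => ?_
        simp only [lt_div_iff₀' hA, Set.indicator, Set.mem_ofPred_eq]
        split_ifs <;> simp
    _ ≤ 16 * (‖d ω‖ / A) * ‖d ω‖ := by gcongr
    _ = _ := by ring

/-- The tail estimate for the maximal function of a stationary sequence of reverse martingale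
differences. -/
lemma measure_maximalFunction_gt_le (hθ : MeasurePreserving θ μ μ) {d : Ω → H}
    (hdm : StronglyMeasurable d) (hd : IsReverseDiff μ θ d) (hd1 : ∫ ω, ‖d ω‖ ^ 2 ∂μ ≤ 1)
    {A s : ℝ} (hA : 0 < A) (hs : 1 ≤ s) :
    μ {ω | ENNReal.ofReal (3 * (s * A)) < maximalFunction θ d ω} ≤
      ENNReal.ofReal (65 / A ^ 2 + tailConst * Real.exp (-(s / 4))) := by
  have hs0 : 0 < s := by linarith
  -- For `s < 10` the right side is at least 1, thanks to the factor `exp (7 / 2)` in `tailConst`.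
  by_cases hs10 : s < 10
  · refine prob_le_one.trans ?_
    rw [ENNReal.one_le_ofReal]
    have h1 : 1 ≤ Real.exp (7 / 2) * Real.exp (-(s / 4)) := by
      rw [← Real.exp_add]; exact Real.one_le_exp (by linarith)
    have h2 : 1 * 1 ≤ (1 + ∑' j, Real.exp (-(2 * LLtwo j)))
        * (Real.exp (7 / 2) * Real.exp (-(s / 4))) :=
      mul_le_mul one_le_tsum_exp h1 zero_le_one (zero_le_one.trans one_le_tsum_exp)
    have h3 : 0 ≤ 65 / A ^ 2 := by positivity
    rw [tailConst]
    nlinarith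
  have hs10 : 10 ≤ s := not_lt.1 hs10
  obtain ⟨w, hwm, hw0, hwi, hw⟩ := exists_transfer_density hθ (hdm.norm.measurable.pow_const 2)
    (fun ω => sq_nonneg ‖d ω‖) (hd.memLp.integrable_norm_pow two_ne_zero)
  have hb : ∀ j, 0 ≤ A * truncLevel j := fun j => mul_nonneg hA.le (truncLevel_pos j).le
  choose D E hDE hD hEm hEi hEb using fun j =>
    exists_truncation hθ hdm hd hwm hw0 hwi hw (hb j)
  set BV : Set Ω := {ω | ∃ n : ℕ, A ^ 2 * n < birkhoffSum θ (w ∘ θ) n ω} with hBV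
  set BE : ℕ → Set Ω := fun j =>
    {ω | s * A * lilNorm (2 ^ j) < birkhoffSum θ (fun ω => ‖E j ω‖) (2 ^ (j + 1)) ω} with hBE
  set BD : ℕ → Set Ω := fun j =>
    {ω | birkhoffSum θ (w ∘ θ) (2 ^ (j + 1)) ω ≤ A ^ 2 * (2 ^ (j + 1) : ℕ) ∧
      ∃ n ≤ 2 ^ (j + 1), 2 * (s * A * lilNorm (2 ^ j)) < ‖birkhoffSum θ (D j) n ω‖} with hBD
  -- Three causes of exceedance: `BV`, large accumulated variance; `BE`, large discarded part; `BD`,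
  -- large bounded part despite moderate variance. The level `3 * s * A` is split as one share for
  -- `E` and two for `D`.
  have hcover : {ω | ENNReal.ofReal (3 * (s * A)) < maximalFunction θ d ω} ⊆
      BV ∪ ((⋃ j, BE j) ∪ ⋃ j, BD j) := by
    intro ω hω
    obtain ⟨n, hn, hlt⟩ := (lt_maximalFunction_iff (by positivity)).1 hω
    by_cases hV : ω ∈ BV
    · exact Or.inl hV
    refine Or.inr ?_
    set j := Nat.log 2 n with hj
    have hj1 : 2 ^ j ≤ n := Nat.pow_log_le_self 2 (by omega)
    have hj2 : n ≤ 2 ^ (j + 1) := (Nat.lt_pow_succ_log_self one_lt_two n).le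
    have hlil := lilNorm_mono hj1
    by_cases hE : ω ∈ BE j
    · exact Or.inl (Set.mem_iUnion.2 ⟨j, hE⟩)
    refine Or.inr (Set.mem_iUnion.2 ⟨j, not_lt.1 fun h => hV ⟨_, h⟩, n, hj2, ?_⟩)
    have h1 : birkhoffSum θ d n ω = birkhoffSum θ (D j) n ω + birkhoffSum θ (E j) n ω := by
      simp only [birkhoffSum, hDE j, Finset.sum_add_distrib]
    have h2 : ‖birkhoffSum θ (E j) n ω‖ ≤ s * A * lilNorm (2 ^ j) := by
      refine ((norm_sum_le _ _).trans ?_).trans (not_lt.1 hE)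
      exact Finset.sum_le_sum_of_subset_of_nonneg (Finset.range_mono hj2)
        fun _ _ _ => norm_nonneg _
    have h3 := norm_add_le (birkhoffSum θ (D j) n ω) (birkhoffSum θ (E j) n ω)
    rw [← h1] at h3
    have h4 : 3 * (s * A) * lilNorm (2 ^ j) ≤ 3 * (s * A) * lilNorm n := by gcongr
    linarith
  have hV : μ BV ≤ ENNReal.ofReal (1 / A ^ 2) := by
    refine (measure_exists_birkhoffSum_gt_le hθ (hwm.comp hθ.measurable)
      (hθ.integrable_comp_of_integrable hwi) (fun ω => hw0 _) (by positivity)).trans ?_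
    refine ENNReal.ofReal_le_ofReal ?_
    gcongr
    have h1 : ∫ ω, (w ∘ θ) ω ∂μ = ∫ ω, w ω ∂μ :=
      integral_comp_of_measurePreserving hθ hwm.aestronglyMeasurable
    have h2 := hw (fun _ => 1) measurable_const
    simp only [one_mul] at h2
    linarith
  have hE : μ (⋃ j, BE j) ≤ ENNReal.ofReal (64 / A ^ 2) := by
    refine (measure_iUnion_le _).trans (ENNReal.tsum_le_of_sum_range_le fun n => ?_)
    calc ∑ j ∈ Finset.range n, μ (BE j)
        ≤ ∑ j ∈ Finset.range n, ENNReal.ofReal (4 / A * (truncLevel j *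
          ∫ ω, {ω | A * truncLevel j < ‖d ω‖}.indicator (fun ω => ‖d ω‖) ω ∂μ)) := by
          refine Finset.sum_le_sum fun j _ => ?_
          have hl := lilNorm_pos (n := 2 ^ j) Nat.one_le_two_pow
          refine (measure_sum_norm_gt_le hθ (hEm j) (hEi j) _ (by positivity)).trans ?_
          refine ENNReal.ofReal_le_ofReal ?_
          set I := ∫ ω, {ω | A * truncLevel j < ‖d ω‖}.indicator (fun ω => ‖d ω‖) ω ∂μ with hI
          have hI0 : 0 ≤ I := integral_nonneg fun ω =>
            Set.indicator_nonneg (fun _ _ => norm_nonneg _) ω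
          have hT := truncLevel_pos j
          rw [div_le_iff₀ (by positivity)]
          have h1 : 4 / A * (truncLevel j * I) * (s * A * lilNorm (2 ^ j))
              = 4 * s * (truncLevel j * lilNorm (2 ^ j)) * I := by field_simp
          rw [h1, truncLevel_mul_lilNorm]
          push_cast
          calc (2 : ℝ) ^ (j + 1) * ∫ ω, ‖E j ω‖ ∂μ ≤ 2 ^ (j + 1) * (2 * I) := by
                gcongr; exact hEb j
            _ = 4 * 1 * 2 ^ j * I := by ring
            _ ≤ _ := by gcongr
      _ = ENNReal.ofReal (4 / A * ∑ j ∈ Finset.range n, truncLevel j *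
          ∫ ω, {ω | A * truncLevel j < ‖d ω‖}.indicator (fun ω => ‖d ω‖) ω ∂μ) := by
          rw [Finset.mul_sum, ENNReal.ofReal_sum_of_nonneg]
          intro j _
          have hI0 : 0 ≤ ∫ ω, {ω | A * truncLevel j < ‖d ω‖}.indicator (fun ω => ‖d ω‖) ω ∂μ :=
            integral_nonneg fun ω => Set.indicator_nonneg (fun _ _ => norm_nonneg _) ω
          have hT := truncLevel_pos j
          positivity
      _ ≤ _ := by
          refine ENNReal.ofReal_le_ofReal ?_
          calc _ ≤ 4 / A * (16 / A * ∫ ω, ‖d ω‖ ^ 2 ∂μ) := by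
                gcongr
                exact sum_truncLevel_mul_integral_le hdm hd.memLp hA n
            _ ≤ 4 / A * (16 / A * 1) := by gcongr
            _ = _ := by field_simp; norm_num
  have hDb : μ (⋃ j, BD j) ≤ ENNReal.ofReal (tailConst * Real.exp (-(s / 4))) := by
    refine (measure_iUnion_le _).trans (ENNReal.tsum_le_of_sum_range_le fun n => ?_)
    calc ∑ j ∈ Finset.range n, μ (BD j)
        ≤ ∑ j ∈ Finset.range n, ENNReal.ofReal
            (Real.exp (7 / 2) * Real.exp (-(s / 4)) * Real.exp (-(2 * LLtwo j))) := by
          refine Finset.sum_le_sum fun j _ => ?_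
          have hT := truncLevel_pos j
          have hL := one_le_LLtwo j
          -- The bound on `D j` is `2 * A * truncLevel j`, so this `l` is the largest with `l * b ≤
          -- 1 / 2`. The exponent becomes `1 - (s / 4 - 3 / 8) * LLtwo j`, which `s ≥ 10` and `LLtwo
          -- j ≥ 1` bound by `7 / 2 - s / 4 - 2 * LLtwo j`.
          refine ((hD j).measure_exists_norm_gt_le hθ (l := 1 / (4 * (A * truncLevel j)))
            (by positivity) (by field_simp; norm_num) _ _ _).trans ?_
          refine ENNReal.ofReal_le_ofReal ?_
          rw [← Real.exp_add, ← Real.exp_add]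
          refine Real.exp_le_exp.2 ?_
          have h1 : 1 / (4 * (A * truncLevel j)) * (s * A * lilNorm (2 ^ j))
              = s / 4 * LLtwo j := by
            rw [lilNorm_eq_truncLevel_mul]; field_simp
          have h2 : (2 : ℝ) ^ j = truncLevel j ^ 2 * LLtwo j := by
            rw [← truncLevel_mul_lilNorm, lilNorm_eq_truncLevel_mul]; ring
          have h3 : 3 * (1 / (4 * (A * truncLevel j))) ^ 2 * (A ^ 2 * (2 ^ (j + 1) : ℕ))
              = 3 / 8 * LLtwo j := by
            push_cast
            rw [pow_succ (2 : ℝ), h2]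
            field_simp
            norm_num
          rw [h1, h3]
          nlinarith
      _ = ENNReal.ofReal (∑ j ∈ Finset.range n,
            Real.exp (7 / 2) * Real.exp (-(s / 4)) * Real.exp (-(2 * LLtwo j))) := by
          rw [ENNReal.ofReal_sum_of_nonneg]
          intro j _
          positivity
      _ ≤ _ := by
          refine ENNReal.ofReal_le_ofReal ?_
          rw [← Finset.mul_sum, tailConst]
          have h1 := summable_exp_neg_two_mul_LLtwo.sum_le_tsum (Finset.range n)
            fun j _ => (Real.exp_pos _).le
          calc _ ≤ Real.exp (7 / 2) * Real.exp (-(s / 4))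
                * (1 + ∑' j, Real.exp (-(2 * LLtwo j))) := by
                gcongr
                linarith
            _ = _ := by ring
  have hexp := Real.exp_pos (-(s / 4))
  have htc := tailConst_pos
  calc _ ≤ μ BV + (μ (⋃ j, BE j) + μ (⋃ j, BD j)) :=
        (measure_mono hcover).trans ((measure_union_le _ _).trans
          (by gcongr; exact measure_union_le _ _))
    _ ≤ ENNReal.ofReal (1 / A ^ 2) + (ENNReal.ofReal (64 / A ^ 2)
        + ENNReal.ofReal (tailConst * Real.exp (-(s / 4)))) := by gcongr
    _ = _ := by
        rw [← ENNReal.ofReal_add (by positivity) (by positivity),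
          ← ENNReal.ofReal_add (by positivity) (by positivity)]
        congr 1
        ring

end Tail
-- From tails to moments.
section StrongType

/-- A tail bound along a geometric sequence of levels controls the moments. -/
lemma rpow_le_add_tsum_indicator {p : ℝ} (hp : 0 < p) {T : ℕ → ℝ≥0∞} (hT1 : ∀ k, 1 ≤ T k)
    (x : ℝ≥0∞) :
    x ^ p ≤ T 0 ^ p + ∑' k, if T k < x then T (k + 1) ^ p else 0 := by
  classical
  by_cases hx : ∃ k, x ≤ T k
  · have hk := Nat.find_spec hx
    rcases hn : Nat.find hx with _ | k
    · rw [hn] at hk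
      exact le_add_right (ENNReal.rpow_le_rpow hk hp.le)
    · have hlt : T k < x := not_le.1 (Nat.find_min hx (by omega))
      rw [hn] at hk
      refine le_add_left ((ENNReal.rpow_le_rpow hk hp.le).trans ?_)
      refine le_trans ?_ (ENNReal.le_tsum k)
      rw [if_pos hlt]
  · push Not at hx
    -- If `x` exceeds every level, the series has infinitely many terms at least 1 and diverges.
    have h : ∑' k, (if T k < x then T (k + 1) ^ p else 0) = ⊤ := by
      rw [eq_top_iff, ← ENNReal.tsum_const_eq_top_of_ne_zero (α := ℕ) one_ne_zero]
      refine ENNReal.tsum_le_tsum fun k => ?_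
      rw [if_pos (hx k)]
      exact ENNReal.one_le_rpow (hT1 _) hp
    rw [h]
    simp

lemma lintegral_rpow_le_add_tsum {Ω : Type*} [MeasurableSpace Ω] {μ : Measure Ω}
    [IsProbabilityMeasure μ] {p : ℝ} (hp : 0 < p) {T : ℕ → ℝ≥0∞} (hT1 : ∀ k, 1 ≤ T k)
    {f : Ω → ℝ≥0∞} (hf : Measurable f) :
    ∫⁻ ω, f ω ^ p ∂μ ≤ T 0 ^ p + ∑' k, T (k + 1) ^ p * μ {ω | T k < f ω} := by
  have hs : ∀ k, MeasurableSet {ω | T k < f ω} := fun k => measurableSet_lt measurable_const hf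
  calc ∫⁻ ω, f ω ^ p ∂μ
      ≤ ∫⁻ ω, (T 0 ^ p + ∑' k, {ω | T k < f ω}.indicator (fun _ => T (k + 1) ^ p) ω) ∂μ :=
        lintegral_mono fun ω => (rpow_le_add_tsum_indicator hp hT1 (f ω)).trans (le_of_eq (by
          simp only [Set.indicator, Set.mem_ofPred_eq]))
    _ = _ := by
        rw [lintegral_add_left measurable_const,
          lintegral_tsum fun k => (measurable_const.indicator (hs k)).aemeasurable]
        simp [lintegral_indicator_const (hs _)]

variable {Ω : Type u} {H : Type v} [NormedAddCommGroup H] {θ : Ω → Ω}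

lemma maximalFunction_const_smul [NormedSpace ℝ H] (c : ℝ) (X : Ω → H) (ω : Ω) :
    maximalFunction θ (c • X) ω = ‖c‖ₑ * maximalFunction θ X ω := by
  simp only [maximalFunction, ENNReal.mul_iSup]
  refine iSup_congr fun n => iSup_congr fun _ => ?_
  have : birkhoffSum θ (c • X) n ω = c • birkhoffSum θ X n ω := by
    simp [birkhoffSum, Finset.smul_sum]
  rw [this, enorm_smul, mul_div_assoc]

variable [MeasurableSpace Ω] {μ : Measure Ω}

lemma measurable_maximalFunction (hθ : Measurable θ) {X : Ω → H} (hX : StronglyMeasurable X) :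
    Measurable (maximalFunction θ X) :=
  Measurable.iSup fun n => Measurable.iSup fun _ =>
    (stronglyMeasurable_birkhoffSum hθ hX n).enorm.div_const _

lemma ae_birkhoffSum_congr (hθ : MeasurePreserving θ μ μ) {X X' : Ω → H} (h : X =ᵐ[μ] X') :
    ∀ᵐ ω ∂μ, ∀ n, birkhoffSum θ X n ω = birkhoffSum θ X' n ω := by
  have h1 : ∀ᵐ ω ∂μ, ∀ k, X (θ^[k] ω) = X' (θ^[k] ω) :=
    ae_all_iff.2 fun k => (hθ.iterate k).quasiMeasurePreserving.ae h
  filter_upwards [h1] with ω hω n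
  exact Finset.sum_congr rfl fun k _ => hω k

lemma maximalFunction_congr (hθ : MeasurePreserving θ μ μ) {X X' : Ω → H} (h : X =ᵐ[μ] X') :
    maximalFunction θ X =ᵐ[μ] maximalFunction θ X' := by
  filter_upwards [ae_birkhoffSum_congr hθ h] with ω hω
  simp only [maximalFunction, hω]

variable [InnerProductSpace ℝ H]

lemma integral_norm_sq_eq {d : Ω → H} (hd : MemLp d 2 μ) :
    ∫ ω, ‖d ω‖ ^ 2 ∂μ = (eLpNorm d 2 μ).toReal ^ 2 := by
  rw [← Lp.norm_toLp d hd, ← real_inner_self_eq_norm_sq, L2.inner_def]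
  refine integral_congr_ae ?_
  filter_upwards [hd.coeFn_toLp] with ω hω
  rw [hω, real_inner_self_eq_norm_sq]

lemma IsReverseDiff.congr {d d' : Ω → H} (h : IsReverseDiff μ θ d) (hd : d =ᵐ[μ] d') :
    IsReverseDiff μ θ d' where
  memLp := h.memLp.ae_eq hd
  orth Y hY := by
    rw [← h.orth Y hY]
    refine integral_congr_ae ?_
    filter_upwards [hd] with ω hω
    rw [hω]

lemma IsReverseDiff.const_smul {d : Ω → H} (h : IsReverseDiff μ θ d) (c : ℝ) :
    IsReverseDiff μ θ (c • d) where
  memLp := h.memLp.const_smul c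
  orth Y hY := by
    simp [inner_smul_right, integral_const_mul, h.orth Y hY]

/-- The polynomial tail estimate along the levels `3 * 2 ^ (M * k)`. -/
lemma measure_maximalFunction_gt_two_pow_le [CompleteSpace H] [IsProbabilityMeasure μ]
    (hθ : MeasurePreserving θ μ μ) {d : Ω → H}
    (hdm : StronglyMeasurable d) (hd : IsReverseDiff μ θ d) (hd1 : ∫ ω, ‖d ω‖ ^ 2 ∂μ ≤ 1)
    (M k : ℕ) :
    μ {ω | ENNReal.ofReal (3 * 2 ^ ((M + 1) * k)) < maximalFunction θ d ω} ≤
      ENNReal.ofReal ((65 + tailConst * ((2 * M).factorial * 4 ^ (2 * M))) *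
        ((1 / 4) ^ M) ^ k) := by
  -- With `A = s ^ M` the level is of order `s ^ (M + 1)` and the tail of order `s ^ (-2M)`.
  have h := measure_maximalFunction_gt_le hθ hdm hd hd1 (A := 2 ^ (M * k)) (s := 2 ^ k)
    (by positivity) (one_le_pow₀ one_le_two)
  rw [← pow_add, show k + M * k = (M + 1) * k by ring] at h
  refine h.trans (ENNReal.ofReal_le_ofReal ?_)
  have htc := tailConst_pos
  have h1 : Real.exp (-((2 : ℝ) ^ k / 4)) ≤
      ((2 * M).factorial * 4 ^ (2 * M)) * ((1 / 4) ^ M) ^ k := by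
    have h2 := Real.pow_div_factorial_le_exp ((2 : ℝ) ^ k / 4) (by positivity) (2 * M)
    rw [Real.exp_neg]
    have h3 : ((2 * M).factorial * 4 ^ (2 * M) : ℝ) * ((1 / 4) ^ M) ^ k
        = (((2 : ℝ) ^ k / 4) ^ (2 * M) / (2 * M).factorial)⁻¹ := by
      have h5 : ((1 / 4 : ℝ) ^ M) ^ k * (2 ^ k) ^ (2 * M) = 1 := by
        rw [← pow_mul, ← pow_mul, show k * (2 * M) = 2 * (M * k) by ring, pow_mul 2 2 (M * k),
          ← mul_pow]
        norm_num
      rw [inv_div, div_pow ((2 : ℝ) ^ k), div_div_eq_mul_div, eq_div_iff (by positivity),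
        mul_assoc, h5, mul_one]
    rw [h3]
    gcongr
  have h4 : 65 / ((2 : ℝ) ^ (M * k)) ^ 2 = 65 * ((1 / 4) ^ M) ^ k := by
    rw [← pow_mul, ← pow_mul, mul_comm (M * k) 2, pow_mul 2 2 (M * k), one_div, inv_pow,
      div_eq_mul_inv]
    norm_num
  rw [h4, add_mul, mul_assoc tailConst]
  gcongr

end StrongType

/-- The constant in the maximal inequality for reverse martingale differences of norm one. -/
lemma exists_lintegral_maximalFunction_le {p : ℝ} (hp1 : 1 < p) (hp2 : p < 2) :
    ∃ C : ℝ≥0∞, C ≠ ⊤ ∧ ∀ (Ω : Type u) [MeasurableSpace Ω] (μ : Measure Ω)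
      [IsProbabilityMeasure μ] (θ : Ω → Ω) (_ : MeasurePreserving θ μ μ)
      (H : Type v) [NormedAddCommGroup H] [InnerProductSpace ℝ H] [CompleteSpace H]
      (d : Ω → H), StronglyMeasurable d → IsReverseDiff μ θ d → ∫ ω, ‖d ω‖ ^ 2 ∂μ ≤ 1 →
      ∫⁻ ω, maximalFunction θ d ω ^ p ∂μ ≤ C := by
  -- This makes `p * (M + 1) < 2 * M`, so the moment series is geometric with ratio `q < 1`.
  obtain ⟨M, hM⟩ := exists_nat_gt (p / (2 - p))
  have hM' : p * (M + 1) < 2 * M := by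
    rw [div_lt_iff₀ (by linarith)] at hM
    linarith
  set T : ℕ → ℝ≥0∞ := fun k => ENNReal.ofReal (3 * 2 ^ ((M + 1) * k)) with hT
  set c : ℝ := 65 + tailConst * ((2 * M).factorial * 4 ^ (2 * M)) with hc
  have hc0 : 0 < c := by have := tailConst_pos; positivity
  have hT1 : ∀ k, 1 ≤ T k := fun k => by
    rw [hT, ENNReal.one_le_ofReal]
    have : (1 : ℝ) ≤ 2 ^ ((M + 1) * k) := one_le_pow₀ one_le_two
    linarith
  have hp0 : 0 < p := by linarith
  set q : ℝ := (2 : ℝ) ^ (p * (M + 1) - 2 * M) with hq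
  have hq1 : q < 1 := Real.rpow_lt_one_of_one_lt_of_neg one_lt_two (by linarith)
  have hq0 : 0 < q := Real.rpow_pos_of_pos two_pos _
  have hterm : ∀ k, T (k + 1) ^ p * ENNReal.ofReal (c * ((1 / 4) ^ M) ^ k)
      = ENNReal.ofReal ((3 * 2 ^ (M + 1)) ^ p * c * q ^ k) := fun k => by
    rw [hT, ENNReal.ofReal_rpow_of_pos (by positivity), ← ENNReal.ofReal_mul (by positivity)]
    congr 1
    have h1 : (3 * 2 ^ ((M + 1) * (k + 1)) : ℝ) = 3 * 2 ^ (M + 1) * (2 ^ (M + 1)) ^ k := by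
      rw [mul_add, mul_one, pow_add, pow_mul]; ring
    have h2 : q = ((2 : ℝ) ^ (M + 1)) ^ p * (1 / 4) ^ M := by
      rw [hq, Real.rpow_sub two_pos, mul_comm p, Real.rpow_mul two_pos.le, div_eq_mul_inv]
      congr 1
      · congr 1
        exact_mod_cast Real.rpow_natCast 2 (M + 1)
      · rw [Real.rpow_mul two_pos.le, Real.rpow_natCast, one_div, inv_pow]
        norm_num
    rw [h1, Real.mul_rpow (by positivity) (by positivity), h2, mul_pow,
      ← Real.rpow_natCast (((2 : ℝ) ^ (M + 1)) ^ p) k, ← Real.rpow_mul (by positivity), mul_comm p,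
      Real.rpow_mul (by positivity), Real.rpow_natCast]
    ring
  refine ⟨T 0 ^ p + ∑' k, ENNReal.ofReal ((3 * 2 ^ (M + 1)) ^ p * c * q ^ k), ?_, ?_⟩
  · refine ENNReal.add_ne_top.2 ⟨ENNReal.rpow_ne_top_of_nonneg hp0.le ENNReal.ofReal_ne_top, ?_⟩
    exact ((summable_geometric_of_lt_one hq0.le hq1).mul_left _).tsum_ofReal_ne_top
  · intro Ω _ μ _ θ hθ H _ _ _ d hdm hd hd1
    refine (lintegral_rpow_le_add_tsum hp0 hT1
      (measurable_maximalFunction hθ.measurable hdm)).trans ?_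
    gcongr with k
    rw [← hterm]
    gcongr
    exact measure_maximalFunction_gt_two_pow_le hθ hdm hd hd1 M k

/-- The maximal inequality for stationary sequences of reverse martingale differences. -/
lemma exists_eLpNorm_maximalFunction_le {p : ℝ} (hp1 : 1 < p) (hp2 : p < 2) :
    ∃ C : ℝ≥0∞, C ≠ ⊤ ∧ ∀ (Ω : Type u) [MeasurableSpace Ω] (μ : Measure Ω)
      [IsProbabilityMeasure μ] (θ : Ω → Ω) (_ : MeasurePreserving θ μ μ)
      (H : Type v) [NormedAddCommGroup H] [InnerProductSpace ℝ H] [CompleteSpace H]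
      (d : Ω → H), IsReverseDiff μ θ d →
      eLpNorm (maximalFunction θ d) (ENNReal.ofReal p) μ ≤ C * eLpNorm d 2 μ := by
  obtain ⟨C, hC, h⟩ := exists_lintegral_maximalFunction_le.{u, v} hp1 hp2
  have hp0 : 0 < p := by linarith
  refine ⟨C ^ (1 / p), ENNReal.rpow_ne_top_of_nonneg (by positivity) hC, ?_⟩
  intro Ω _ μ _ θ hθ H _ _ _ d' hd'
  obtain ⟨d, hdm, hdd⟩ := hd'.memLp.1
  have hd : IsReverseDiff μ θ d := hd'.congr hdd
  rw [eLpNorm_congr_ae (maximalFunction_congr hθ hdd), eLpNorm_congr_ae hdd]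
  have hp : ENNReal.ofReal p ≠ 0 := by simpa using hp0
  by_cases h0 : eLpNorm d 2 μ = 0
  · have hd0 : d =ᵐ[μ] 0 := (eLpNorm_eq_zero_iff hd.memLp.1 two_ne_zero).1 h0
    have h1 : maximalFunction θ (0 : Ω → H) = 0 := by
      funext ω
      simp [maximalFunction, birkhoffSum]
    rw [eLpNorm_congr_ae (maximalFunction_congr hθ hd0), h1, eLpNorm_zero]
    exact zero_le
  set σ : ℝ := (eLpNorm d 2 μ).toReal with hσ
  have hσ0 : 0 < σ := ENNReal.toReal_pos h0 hd.memLp.2.ne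
  have hσe : ‖σ‖ₑ = eLpNorm d 2 μ := by
    rw [Real.enorm_of_nonneg hσ0.le, hσ, ENNReal.ofReal_toReal hd.memLp.2.ne]
  have h1 : ∫ ω, ‖(σ⁻¹ • d) ω‖ ^ 2 ∂μ ≤ 1 := by
    simp only [Pi.smul_apply, norm_smul, mul_pow, integral_const_mul]
    rw [integral_norm_sq_eq hd.memLp, ← hσ, norm_inv, Real.norm_of_nonneg hσ0.le, ← mul_pow,
      inv_mul_cancel₀ hσ0.ne', one_pow]
  have h2 := h Ω μ θ hθ H (σ⁻¹ • d) (hdm.const_smul _) (hd.const_smul _) h1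
  have h3 : eLpNorm (maximalFunction θ (σ⁻¹ • d)) (ENNReal.ofReal p) μ ≤ C ^ (1 / p) := by
    rw [eLpNorm_eq_lintegral_rpow_enorm_toReal hp ENNReal.ofReal_ne_top,
      ENNReal.toReal_ofReal hp0.le]
    simp only [enorm_eq_self]
    gcongr
  have h4 : ∀ ω, maximalFunction θ d ω = ‖σ‖ₑ * maximalFunction θ (σ⁻¹ • d) ω := fun ω => by
    rw [← maximalFunction_const_smul, smul_smul, mul_inv_cancel₀ hσ0.ne', one_smul]
  have h5 := eLpNorm_le_nnreal_smul_eLpNorm_of_ae_le_mul' (μ := μ) (c := ‖σ‖₊)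
    (f := maximalFunction θ d) (g := maximalFunction θ (σ⁻¹ • d))
    (Eventually.of_forall fun ω => (h4 ω).le) (ENNReal.ofReal p)
  refine h5.trans ?_
  rw [ENNReal.smul_def, smul_eq_mul, mul_comm, ← hσe]
  exact mul_le_mul_left h3 _

/-! ### Expansion into differences for an isometry and its adjoint. -/

section Decomposition

lemma sqrt_succ_sub_sqrt_le (m : ℕ) : √((m : ℝ) + 1) - √(m : ℝ) ≤ 1 / √((m : ℝ) + 1) := by
  have h0 : 0 < √((m : ℝ) + 1) := Real.sqrt_pos.2 (by positivity)
  have h1 := Real.sq_sqrt (show (0 : ℝ) ≤ (m : ℝ) + 1 by positivity)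
  have h2 := Real.sq_sqrt (show (0 : ℝ) ≤ (m : ℝ) by positivity)
  have h3 : √(m : ℝ) ≤ √((m : ℝ) + 1) := Real.sqrt_le_sqrt (by linarith)
  have h4 := Real.sqrt_nonneg (m : ℝ)
  rw [le_div_iff₀ h0]
  nlinarith

/-- Abel summation. The boundary term is kept because it later yields decay of `‖K ^ m x‖`. -/
lemma sum_sqrt_mul_sub_add_le {a : ℕ → ℝ} (ha : ∀ n, 0 ≤ a n) (m : ℕ) :
    ∑ n ∈ Finset.range m, √((n : ℝ) + 1) * (a n - a (n + 1)) + √(m : ℝ) * a m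
      ≤ ∑ n ∈ Finset.range m, a n / √((n : ℝ) + 1) := by
  induction m with
  | zero => simp
  | succ m ih =>
    rw [Finset.sum_range_succ, Finset.sum_range_succ]
    have h := mul_le_mul_of_nonneg_left (sqrt_succ_sub_sqrt_le m) (ha m)
    rw [mul_one_div] at h
    push_cast
    linarith

lemma sum_range_div_sqrt_le {a : ℕ → ℝ} (ha : ∀ n, 0 ≤ a n)
    (hs : Summable fun n : ℕ => a (n + 1) / √((n : ℝ) + 1)) (m : ℕ) :
    ∑ n ∈ Finset.range m, a n / √((n : ℝ) + 1)
      ≤ a 0 + ∑' n : ℕ, a (n + 1) / √((n : ℝ) + 1) := by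
  have hnn : ∀ n : ℕ, 0 ≤ a (n + 1) / √((n : ℝ) + 1) := fun n =>
    div_nonneg (ha _) (Real.sqrt_nonneg _)
  have h1 := hs.sum_le_tsum (Finset.range m) fun n _ => hnn n
  calc ∑ n ∈ Finset.range m, a n / √((n : ℝ) + 1)
      ≤ ∑ n ∈ Finset.range (m + 1), a n / √((n : ℝ) + 1) :=
        Finset.sum_le_sum_of_subset_of_nonneg (Finset.range_mono (Nat.le_succ m))
          fun n _ _ => div_nonneg (ha _) (Real.sqrt_nonneg _)
    _ = ∑ n ∈ Finset.range m, a (n + 1) / √(((n + 1 : ℕ) : ℝ) + 1) + a 0 := by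
        rw [Finset.sum_range_succ']; simp
    _ ≤ ∑ n ∈ Finset.range m, a (n + 1) / √((n : ℝ) + 1) + a 0 := by
        gcongr with n
        · exact ha _
        · linarith
    _ ≤ _ := by linarith

/-- Arithmetic-geometric mean applied to `x² - y² ≤ 2x(x - y)`, with a free weight `c`, later `√(n +
1)`. -/
lemma sqrt_sq_sub_sq_le {x y c : ℝ} (hx : 0 ≤ x) (hyx : y ≤ x) (hc : 0 < c) :
    √(x ^ 2 - y ^ 2) ≤ c * (x - y) + x / (2 * c) := by
  have h1 : 0 ≤ c * (x - y) + x / (2 * c) :=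
    add_nonneg (mul_nonneg hc.le (by linarith)) (by positivity)
  rw [Real.sqrt_le_left h1]
  have h2 : c * (x - y) * (x / (2 * c)) = (x - y) * x / 2 := by field_simp
  have h3 : (c * (x - y) + x / (2 * c)) ^ 2
      = (c * (x - y) - x / (2 * c)) ^ 2 + 4 * (c * (x - y) * (x / (2 * c))) := by ring
  rw [h3, h2]
  nlinarith [sq_nonneg (c * (x - y) - x / (2 * c)), sq_nonneg (x - y)]

variable {E : Type*} [NormedAddCommGroup E] [InnerProductSpace ℝ E]

/-- The `n`-th reverse martingale difference in the expansion of `x`. -/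
noncomputable def diffTerm (U : E →ₗᵢ[ℝ] E) (K : E →L[ℝ] E) (x : E) (n : ℕ) : E :=
  (K ^ n) x - U ((K ^ (n + 1)) x)

variable {U : E →ₗᵢ[ℝ] E} {K : E →L[ℝ] E}

lemma adjoint_apply_isometry (hK : ∀ x y, inner ℝ (K x) y = inner ℝ x (U y)) (x : E) :
    K (U x) = x :=
  ext_inner_right ℝ fun y => by rw [hK, U.inner_map_map]

lemma map_diffTerm (hK : ∀ x y, inner ℝ (K x) y = inner ℝ x (U y)) (x : E) (n : ℕ) :
    K (diffTerm U K x n) = 0 := by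
  rw [diffTerm, map_sub, adjoint_apply_isometry hK, pow_succ', mul_apply_eq_comp,
    sub_self]

/-- Pythagoras: `U K` is the orthogonal projection onto the range of `U`. -/
lemma norm_diffTerm_sq (hK : ∀ x y, inner ℝ (K x) y = inner ℝ x (U y)) (x : E) (n : ℕ) :
    ‖diffTerm U K x n‖ ^ 2 = ‖(K ^ n) x‖ ^ 2 - ‖(K ^ (n + 1)) x‖ ^ 2 := by
  rw [diffTerm, norm_sub_sq_real, ← hK, pow_succ' K n, mul_apply_eq_comp,
    real_inner_self_eq_norm_sq, U.norm_map]
  ring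

lemma norm_pow_succ_le (hK : ∀ x y, inner ℝ (K x) y = inner ℝ x (U y)) (x : E) (n : ℕ) :
    ‖(K ^ (n + 1)) x‖ ≤ ‖(K ^ n) x‖ := by
  have h := norm_diffTerm_sq hK x n
  exact le_of_sq_le_sq (by nlinarith [sq_nonneg ‖diffTerm U K x n‖]) (norm_nonneg _)

lemma sum_norm_diffTerm_le (hK : ∀ x y, inner ℝ (K x) y = inner ℝ x (U y)) {x : E}
    (hs : Summable fun n : ℕ => ‖(K ^ (n + 1)) x‖ / √((n : ℝ) + 1)) (m : ℕ) :
    ∑ n ∈ Finset.range m, ‖diffTerm U K x n‖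
      ≤ 2 * (‖(K ^ 0) x‖ + ∑' n : ℕ, ‖(K ^ (n + 1)) x‖ / √((n : ℝ) + 1)) := by
  have h1 := sum_sqrt_mul_sub_add_le (a := fun n => ‖(K ^ n) x‖) (fun _ => norm_nonneg _) m
  have h2 := sum_range_div_sqrt_le (a := fun n => ‖(K ^ n) x‖) (fun _ => norm_nonneg _) hs m
  have h3 : 0 ≤ √(m : ℝ) * ‖(K ^ m) x‖ := by positivity
  have h5 : 0 ≤ ∑ n ∈ Finset.range m, ‖(K ^ n) x‖ / √((n : ℝ) + 1) :=
    Finset.sum_nonneg fun _ _ => by positivity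
  have h4 : ∑ n ∈ Finset.range m, ‖diffTerm U K x n‖ ≤
      ∑ n ∈ Finset.range m, √((n : ℝ) + 1) * (‖(K ^ n) x‖ - ‖(K ^ (n + 1)) x‖)
        + (1 / 2) * ∑ n ∈ Finset.range m, ‖(K ^ n) x‖ / √((n : ℝ) + 1) := by
    rw [Finset.mul_sum, ← Finset.sum_add_distrib]
    refine Finset.sum_le_sum fun n _ => ?_
    have h := sqrt_sq_sub_sq_le (norm_nonneg ((K ^ n) x))
      (norm_pow_succ_le hK x n) (Real.sqrt_pos.2 (show (0 : ℝ) < (n : ℝ) + 1 by positivity))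
    rw [← norm_diffTerm_sq hK, Real.sqrt_sq (norm_nonneg _)] at h
    refine h.trans (le_of_eq ?_)
    ring
  linarith

lemma summable_norm_diffTerm (hK : ∀ x y, inner ℝ (K x) y = inner ℝ x (U y)) {x : E}
    (hs : Summable fun n : ℕ => ‖(K ^ (n + 1)) x‖ / √((n : ℝ) + 1)) :
    Summable fun n => ‖diffTerm U K x n‖ :=
  summable_of_sum_range_le (fun _ => norm_nonneg _) (sum_norm_diffTerm_le hK hs)

/-- The boundary term of the Abel summation keeps `√m * ‖K ^ m x‖` bounded. -/
lemma tendsto_norm_pow_zero {x : E}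
    (hs : Summable fun n : ℕ => ‖(K ^ (n + 1)) x‖ / √((n : ℝ) + 1))
    (hK : ∀ x y, inner ℝ (K x) y = inner ℝ x (U y)) :
    Tendsto (fun m : ℕ => ‖(K ^ m) x‖) atTop (nhds 0) := by
  set N := ‖(K ^ 0) x‖ + ∑' n : ℕ, ‖(K ^ (n + 1)) x‖ / √((n : ℝ) + 1) with hN
  have h0 : Tendsto (fun m : ℕ => N / √(m : ℝ)) atTop (nhds 0) :=
    tendsto_const_nhds.div_atTop (Real.tendsto_sqrt_atTop.comp tendsto_natCast_atTop_atTop)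
  refine squeeze_zero' (Eventually.of_forall fun _ => norm_nonneg _) ?_ h0
  filter_upwards [eventually_ge_atTop 1] with m hm
  have hm' : 0 < √(m : ℝ) := Real.sqrt_pos.2 (by exact_mod_cast hm)
  have h1 := sum_sqrt_mul_sub_add_le (a := fun n => ‖(K ^ n) x‖) (fun _ => norm_nonneg _) m
  have h2 := sum_range_div_sqrt_le (a := fun n => ‖(K ^ n) x‖) (fun _ => norm_nonneg _) hs m
  have h3 : 0 ≤ ∑ n ∈ Finset.range m, √((n : ℝ) + 1) * (‖(K ^ n) x‖ - ‖(K ^ (n + 1)) x‖) :=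
    Finset.sum_nonneg fun n _ => mul_nonneg (Real.sqrt_nonneg _)
      (sub_nonneg.2 (norm_pow_succ_le hK x n))
  rw [le_div_iff₀ hm', mul_comm]
  linarith

lemma sum_iterate_diffTerm (x : E) (m : ℕ) :
    ∑ n ∈ Finset.range m, U^[n] (diffTerm U K x n) = x - U^[m] ((K ^ m) x) := by
  induction m with
  | zero => simp
  | succ m ih =>
    have h : U^[m] (diffTerm U K x m) = U^[m] ((K ^ m) x) - U^[m + 1] ((K ^ (m + 1)) x) := by
      rw [diffTerm, iterate_map_sub, Function.iterate_succ_apply]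
    rw [Finset.sum_range_succ, ih, h]
    abel

lemma norm_iterate_isometry (x : E) (n : ℕ) : ‖U^[n] x‖ = ‖x‖ := by
  induction n with
  | zero => rfl
  | succ n ih => rw [Function.iterate_succ_apply', U.norm_map, ih]

lemma hasSum_iterate_diffTerm [CompleteSpace E]
    (hK : ∀ x y, inner ℝ (K x) y = inner ℝ x (U y)) {x : E}
    (hs : Summable fun n : ℕ => ‖(K ^ (n + 1)) x‖ / √((n : ℝ) + 1)) :
    HasSum (fun n => U^[n] (diffTerm U K x n)) x := by
  have h1 : Summable fun n => U^[n] (diffTerm U K x n) :=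
    Summable.of_norm (by simpa only [norm_iterate_isometry] using summable_norm_diffTerm hK hs)
  rw [h1.hasSum_iff_tendsto_nat]
  simp only [sum_iterate_diffTerm]
  have h2 : Tendsto (fun m => U^[m] ((K ^ m) x)) atTop (nhds 0) := by
    rw [tendsto_zero_iff_norm_tendsto_zero]
    simpa only [norm_iterate_isometry] using tendsto_norm_pow_zero hs hK
  simpa using tendsto_const_nhds.sub h2

end Decomposition

/-! ### The maximal norm: subadditivity, invariance, lower semicontinuity. -/

section MaxNorm

variable {Ω : Type u} {H : Type v} [NormedAddCommGroup H] {θ : Ω → Ω}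

lemma maximalFunction_add_le (X Y : Ω → H) (ω : Ω) :
    maximalFunction θ (X + Y) ω ≤ maximalFunction θ X ω + maximalFunction θ Y ω := by
  refine iSup₂_le fun n hn => ?_
  have h : birkhoffSum θ (X + Y) n ω = birkhoffSum θ X n ω + birkhoffSum θ Y n ω := by
    simp [birkhoffSum, Finset.sum_add_distrib]
  rw [h]
  refine (ENNReal.div_le_div_right (enorm_add_le _ _) _).trans ?_
  rw [ENNReal.add_div]
  exact add_le_add (le_iSup₂ (f := fun n (_ : 1 ≤ n) =>
    ‖birkhoffSum θ X n ω‖ₑ / ENNReal.ofReal (lilNorm n)) n hn)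
    (le_iSup₂ (f := fun n (_ : 1 ≤ n) =>
    ‖birkhoffSum θ Y n ω‖ₑ / ENNReal.ofReal (lilNorm n)) n hn)

lemma maximalFunction_neg (X : Ω → H) : maximalFunction θ (-X) = maximalFunction θ X := by
  funext ω
  simp [maximalFunction, birkhoffSum, Finset.sum_neg_distrib]

lemma birkhoffSum_comp_self (X : Ω → H) (n : ℕ) (ω : Ω) :
    birkhoffSum θ (X ∘ θ) n ω = birkhoffSum θ X n (θ ω) :=
  Finset.sum_congr rfl fun k _ => by
    rw [Function.comp_apply, ← Function.iterate_succ_apply' θ k ω, Function.iterate_succ_apply]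

lemma maximalFunction_comp_self (X : Ω → H) :
    maximalFunction θ (X ∘ θ) = maximalFunction θ X ∘ θ := by
  funext ω
  simp only [maximalFunction, birkhoffSum_comp_self, Function.comp_apply]

variable [MeasurableSpace Ω] {μ : Measure Ω}

/-- The `L^p` norm of the maximal function. -/
noncomputable def maxNorm (θ : Ω → Ω) (p : ℝ) (Y : Lp H 2 μ) : ℝ≥0∞ :=
  eLpNorm (maximalFunction θ Y) (ENNReal.ofReal p) μ

variable {p : ℝ}

lemma maxNorm_toLp (hθ : MeasurePreserving θ μ μ) {X : Ω → H} (hX : MemLp X 2 μ) :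
    maxNorm θ p (hX.toLp X) = eLpNorm (maximalFunction θ X) (ENNReal.ofReal p) μ :=
  eLpNorm_congr_ae (maximalFunction_congr hθ hX.coeFn_toLp)

lemma measurable_maximalFunction_lp (hθ : MeasurePreserving θ μ μ) (Y : Lp H 2 μ) :
    Measurable (maximalFunction θ Y) :=
  measurable_maximalFunction hθ.measurable (Lp.stronglyMeasurable Y)

lemma maxNorm_zero (hθ : MeasurePreserving θ μ μ) : maxNorm θ p (0 : Lp H 2 μ) = 0 := by
  have h : maximalFunction θ (0 : Ω → H) = 0 := by
    funext ω
    simp [maximalFunction, birkhoffSum]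
  rw [maxNorm, eLpNorm_congr_ae (maximalFunction_congr hθ (Lp.coeFn_zero H 2 μ)), h, eLpNorm_zero]

lemma maxNorm_neg (hθ : MeasurePreserving θ μ μ) (Y : Lp H 2 μ) :
    maxNorm θ p (-Y) = maxNorm θ p Y := by
  rw [maxNorm, eLpNorm_congr_ae (maximalFunction_congr hθ (Lp.coeFn_neg Y)), maximalFunction_neg,
    maxNorm]

lemma maxNorm_add_le (hθ : MeasurePreserving θ μ μ) (hp : 1 ≤ p) (Y Z : Lp H 2 μ) :
    maxNorm θ p (Y + Z) ≤ maxNorm θ p Y + maxNorm θ p Z := by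
  rw [maxNorm, eLpNorm_congr_ae (maximalFunction_congr hθ (Lp.coeFn_add Y Z))]
  calc _ ≤ eLpNorm (maximalFunction θ Y + maximalFunction θ Z) (ENNReal.ofReal p) μ :=
        eLpNorm_mono_enorm fun ω => by
          simpa only [enorm_eq_self, Pi.add_apply] using maximalFunction_add_le _ _ ω
    _ ≤ _ := eLpNorm_add_le (measurable_maximalFunction_lp hθ Y).aestronglyMeasurable
        (measurable_maximalFunction_lp hθ Z).aestronglyMeasurable (ENNReal.one_le_ofReal.2 hp)

lemma maxNorm_sub_le (hθ : MeasurePreserving θ μ μ) (hp : 1 ≤ p) (Y Z : Lp H 2 μ) :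
    maxNorm θ p (Y - Z) ≤ maxNorm θ p Y + maxNorm θ p Z := by
  rw [sub_eq_add_neg, ← maxNorm_neg hθ Z]
  exact maxNorm_add_le hθ hp _ _

lemma maxNorm_sum_le (hθ : MeasurePreserving θ μ μ) (hp : 1 ≤ p) (y : ℕ → Lp H 2 μ) (m : ℕ) :
    maxNorm θ p (∑ n ∈ Finset.range m, y n) ≤ ∑ n ∈ Finset.range m, maxNorm θ p (y n) := by
  induction m with
  | zero => simp [maxNorm_zero hθ]
  | succ m ih =>
    rw [Finset.sum_range_succ, Finset.sum_range_succ]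
    exact (maxNorm_add_le hθ hp _ _).trans (by gcongr)

lemma maxNorm_eq_lintegral (hp : 0 < p) (Y : Lp H 2 μ) :
    maxNorm θ p Y = (∫⁻ ω, maximalFunction θ Y ω ^ p ∂μ) ^ (1 / p) := by
  rw [maxNorm, eLpNorm_eq_lintegral_rpow_enorm_toReal (by simpa using hp) ENNReal.ofReal_ne_top,
    ENNReal.toReal_ofReal hp.le]
  simp only [enorm_eq_self]

omit [MeasurableSpace Ω] in
lemma maximalFunction_le_liminf {X : Ω → H} {Y : ℕ → Ω → H} {ω : Ω}
    (h : ∀ k, Tendsto (fun m => Y m (θ^[k] ω)) atTop (nhds (X (θ^[k] ω)))) :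
    maximalFunction θ X ω ≤ liminf (fun m => maximalFunction θ (Y m) ω) atTop := by
  refine iSup₂_le fun n hn => ?_
  have h1 : Tendsto (fun m => birkhoffSum θ (Y m) n ω) atTop (nhds (birkhoffSum θ X n ω)) :=
    tendsto_finsetSum _ fun k _ => h k
  have h2 : Tendsto (fun m => ‖birkhoffSum θ (Y m) n ω‖ₑ / ENNReal.ofReal (lilNorm n)) atTop
      (nhds (‖birkhoffSum θ X n ω‖ₑ / ENNReal.ofReal (lilNorm n))) := by
    refine ENNReal.Tendsto.div_const h1.enorm (Or.inr ?_)
    simpa using lilNorm_pos hn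
  rw [← h2.liminf_eq]
  refine liminf_le_liminf (Eventually.of_forall fun m => ?_)
  exact le_iSup₂ (f := fun n (_ : 1 ≤ n) =>
    ‖birkhoffSum θ (Y m) n ω‖ₑ / ENNReal.ofReal (lilNorm n)) n hn

/-- Fatou along an almost everywhere convergent subsequence. Convergence holds along whole orbits
because `θ` preserves null sets. -/
lemma maxNorm_le_of_tendsto (hθ : MeasurePreserving θ μ μ) (hp : 0 < p) {Y : ℕ → Lp H 2 μ}
    {X : Lp H 2 μ} (h : Tendsto Y atTop (nhds X)) {c : ℝ≥0∞} (hc : ∀ m, maxNorm θ p (Y m) ≤ c) :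
    maxNorm θ p X ≤ c := by
  have h1 : TendstoInMeasure μ (fun m => (Y m : Ω → H)) atTop X :=
    tendstoInMeasure_of_tendsto_Lp h
  obtain ⟨ns, -, hns⟩ := h1.exists_seq_tendsto_ae
  have h2 : ∀ᵐ ω ∂μ, ∀ k, Tendsto (fun i => Y (ns i) (θ^[k] ω)) atTop (nhds (X (θ^[k] ω))) :=
    ae_all_iff.2 fun k => (hθ.iterate k).quasiMeasurePreserving.ae hns
  have h3 : ∫⁻ ω, maximalFunction θ X ω ^ p ∂μ ≤ c ^ p := by
    calc ∫⁻ ω, maximalFunction θ X ω ^ p ∂μ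
        ≤ ∫⁻ ω, liminf (fun i => maximalFunction θ (Y (ns i)) ω ^ p) atTop ∂μ := by
          refine lintegral_mono_ae ?_
          filter_upwards [h2] with ω hω
          have h4 := ENNReal.rpow_le_rpow (maximalFunction_le_liminf hω) hp.le
          refine h4.trans (le_of_eq ?_)
          exact (ENNReal.orderIsoRpow p hp).liminf_apply
      _ ≤ liminf (fun i => ∫⁻ ω, maximalFunction θ (Y (ns i)) ω ^ p ∂μ) atTop :=
          lintegral_liminf_le fun i => (measurable_maximalFunction_lp hθ _).pow_const p
      _ ≤ liminf (fun _ : ℕ => c ^ p) atTop := by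
          refine liminf_le_liminf (Eventually.of_forall fun i => ?_)
          have h5 := ENNReal.rpow_le_rpow (hc (ns i)) hp.le
          rwa [maxNorm_eq_lintegral hp, ← ENNReal.rpow_mul, one_div_mul_cancel hp.ne',
            ENNReal.rpow_one] at h5
      _ = c ^ p := liminf_const _
  rw [maxNorm_eq_lintegral hp]
  calc _ ≤ (c ^ p) ^ (1 / p) := ENNReal.rpow_le_rpow h3 (by positivity)
    _ = c := by rw [← ENNReal.rpow_mul, mul_one_div_cancel hp.ne', ENNReal.rpow_one]

lemma maxNorm_le_tsum (hθ : MeasurePreserving θ μ μ) (hp : 1 ≤ p) {y : ℕ → Lp H 2 μ}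
    {X : Lp H 2 μ} (h : HasSum y X) : maxNorm θ p X ≤ ∑' n, maxNorm θ p (y n) :=
  maxNorm_le_of_tendsto hθ (by linarith) h.tendsto_sum_nat fun m =>
    (maxNorm_sum_le hθ hp y m).trans (ENNReal.sum_le_tsum _)

variable [InnerProductSpace ℝ H]

/-- The Koopman operator `Y ↦ Y ∘ θ` on `L²`. -/
noncomputable def koopman (hθ : MeasurePreserving θ μ μ) : Lp H 2 μ →ₗᵢ[ℝ] Lp H 2 μ :=
  Lp.compMeasurePreservingₗᵢ ℝ (E := H) (p := 2) θ hθ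

lemma coeFn_koopman (hθ : MeasurePreserving θ μ μ) (Y : Lp H 2 μ) :
    koopman hθ Y =ᵐ[μ] Y ∘ θ := Lp.coeFn_compMeasurePreserving Y hθ

lemma maxNorm_koopman (hθ : MeasurePreserving θ μ μ) (Y : Lp H 2 μ) :
    maxNorm θ p (koopman hθ Y) = maxNorm θ p Y := by
  rw [maxNorm, eLpNorm_congr_ae (maximalFunction_congr hθ (coeFn_koopman hθ Y)),
    maximalFunction_comp_self,
    eLpNorm_comp_measurePreserving (measurable_maximalFunction_lp hθ Y).aestronglyMeasurable hθ,
    maxNorm]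

lemma maxNorm_iterate_koopman (hθ : MeasurePreserving θ μ μ) (Y : Lp H 2 μ) (n : ℕ) :
    maxNorm θ p ((koopman hθ)^[n] Y) = maxNorm θ p Y := by
  induction n with
  | zero => rfl
  | succ n ih => rw [Function.iterate_succ_apply', maxNorm_koopman, ih]

variable [CompleteSpace H]

lemma inner_perronFrobenius (hθ : MeasurePreserving θ μ μ) (X Y : Lp H 2 μ) :
    inner ℝ (perronFrobenius hθ X) Y = inner ℝ X (koopman hθ Y) :=
  ContinuousLinearMap.adjoint_inner_left _ _ _

lemma isReverseDiff_of_perronFrobenius_eq_zero (hθ : MeasurePreserving θ μ μ) {d : Lp H 2 μ}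
    (hd : perronFrobenius hθ d = 0) : IsReverseDiff μ θ d where
  memLp := Lp.memLp d
  orth Y hY := by
    have h := inner_perronFrobenius hθ d (hY.toLp Y)
    rw [hd, inner_zero_left, L2.inner_def] at h
    rw [h]
    refine integral_congr_ae ?_
    filter_upwards [coeFn_koopman hθ (hY.toLp Y), hθ.quasiMeasurePreserving.ae hY.coeFn_toLp]
      with ω h1 h2
    rw [h1, Function.comp_apply, h2, real_inner_comm]

lemma maxNorm_le_of_perronFrobenius_eq_zero {C : ℝ≥0∞}
    (hC : ∀ d : Ω → H, IsReverseDiff μ θ d →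
      eLpNorm (maximalFunction θ d) (ENNReal.ofReal p) μ ≤ C * eLpNorm d 2 μ)
    (hθ : MeasurePreserving θ μ μ) {d : Lp H 2 μ} (hd : perronFrobenius hθ d = 0) :
    maxNorm θ p d ≤ C * ‖d‖ₑ := by
  rw [Lp.enorm_def]
  exact hC _ (isReverseDiff_of_perronFrobenius_eq_zero hθ hd)

lemma tsum_enorm_diffTerm_le (hθ : MeasurePreserving θ μ μ) {X : Ω → H} (hX : MemLp X 2 μ)
    (hs : SeriesFinite hθ hX) :
    ∑' n, ‖diffTerm (koopman hθ) (perronFrobenius hθ) (hX.toLp X) n‖ₑ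
      ≤ ENNReal.ofReal (2 * seriesNorm hθ hX) := by
  refine ENNReal.tsum_le_of_sum_range_le fun m => ?_
  simp only [← ofReal_norm]
  rw [← ENNReal.ofReal_sum_of_nonneg fun _ _ => norm_nonneg _]
  exact ENNReal.ofReal_le_ofReal (sum_norm_diffTerm_le (inner_perronFrobenius hθ) hs m)

/-- The maximal inequality, deduced from the one for reverse martingale differences. -/
lemma eLpNorm_maximalFunction_le_seriesNorm {C : ℝ≥0∞}
    (hC : ∀ d : Ω → H, IsReverseDiff μ θ d →
      eLpNorm (maximalFunction θ d) (ENNReal.ofReal p) μ ≤ C * eLpNorm d 2 μ) (hp : 1 ≤ p)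
    (hθ : MeasurePreserving θ μ μ) {X : Ω → H} (hX : MemLp X 2 μ) (hs : SeriesFinite hθ hX) :
    eLpNorm (maximalFunction θ X) (ENNReal.ofReal p) μ
      ≤ C * ENNReal.ofReal (2 * seriesNorm hθ hX) := by
  rw [← maxNorm_toLp hθ hX]
  calc _ ≤ ∑' n, maxNorm θ p ((koopman hθ)^[n]
        (diffTerm (koopman hθ) (perronFrobenius hθ) (hX.toLp X) n)) :=
        maxNorm_le_tsum hθ hp (hasSum_iterate_diffTerm (inner_perronFrobenius hθ) hs)
    _ ≤ ∑' n, C * ‖diffTerm (koopman hθ) (perronFrobenius hθ) (hX.toLp X) n‖ₑ := by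
        refine ENNReal.tsum_le_tsum fun n => ?_
        rw [maxNorm_iterate_koopman]
        exact maxNorm_le_of_perronFrobenius_eq_zero hC hθ
          (map_diffTerm (inner_perronFrobenius hθ) _ n)
    _ ≤ _ := by
        rw [ENNReal.tsum_mul_left]
        gcongr
        exact tsum_enorm_diffTerm_le hθ hX hs

end MaxNorm
-- Coboundaries and the reverse martingale approximation.
section Approximation

variable {Ω : Type u} {H : Type v} [NormedAddCommGroup H] {θ : Ω → Ω}

lemma tendsto_lilNorm : Tendsto lilNorm atTop atTop :=
  tendsto_atTop_mono sqrt_le_lilNorm (Real.tendsto_sqrt_atTop.comp tendsto_natCast_atTop_atTop)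

lemma norm_birkhoffSum_le_of_maximalFunction_le {X : Ω → H} {ω : Ω} {c : ℝ} (hc : 0 ≤ c)
    (h : maximalFunction θ X ω ≤ ENNReal.ofReal c) (n : ℕ) :
    ‖birkhoffSum θ X n ω‖ ≤ c * lilNorm n := by
  rcases Nat.eq_zero_or_pos n with rfl | hn
  · simpa using mul_nonneg hc (lilNorm_nonneg 0)
  · by_contra hlt
    exact (not_lt.2 h) ((lt_maximalFunction_iff hc).2 ⟨n, hn, not_le.1 hlt⟩)

variable [mΩ : MeasurableSpace Ω] {μ : Measure Ω}

/-- Borel–Cantelli: `‖Y‖²` is integrable, so for each constant `c` the probabilities of `c * ‖Y ∘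
θ^n‖² > n` are summable. -/
lemma ae_isLittleO_iterate [IsProbabilityMeasure μ] (hθ : MeasurePreserving θ μ μ) {Y : Ω → H}
    (hYm : StronglyMeasurable Y) (hY : MemLp Y 2 μ) :
    ∀ᵐ ω ∂μ, (fun n : ℕ => Y (θ^[n] ω)) =o[atTop] lilNorm := by
  have key : ∀ m : ℕ, ∀ᵐ ω ∂μ, ∀ᶠ n : ℕ in atTop,
      ‖Y (θ^[n] ω)‖ ≤ 1 / ((m : ℝ) + 1) * lilNorm n := by
    intro m
    set Z : Ω → ℝ := fun ω => ((m : ℝ) + 1) ^ 2 * ‖Y ω‖ ^ 2 with hZ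
    have hZi : Integrable Z μ := (hY.integrable_norm_pow two_ne_zero).const_mul _
    have hZ0 : 0 ≤ Z := fun ω => by simp only [hZ]; positivity
    have hZm : Measurable Z := (hYm.norm.measurable.pow_const 2).const_mul _
    have h1 : ∑' j : ℕ, μ {ω | Z ω ∈ Set.Ioi (j : ℝ)} < ∞ := by
      let _ : MeasureSpace Ω := ⟨μ⟩
      have : IsProbabilityMeasure (volume : Measure Ω) := ‹IsProbabilityMeasure μ›
      exact ProbabilityTheory.tsum_prob_mem_Ioi_lt_top hZi hZ0
    have h2 : ∀ j : ℕ, μ (θ^[j] ⁻¹' {ω | Z ω ∈ Set.Ioi (j : ℝ)}) = μ {ω | Z ω ∈ Set.Ioi (j : ℝ)} :=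
      fun j => (hθ.iterate j).measure_preimage (hZm measurableSet_Ioi).nullMeasurableSet
    simp only [← h2] at h1
    filter_upwards [ae_eventually_notMem h1.ne] with ω hω
    filter_upwards [hω] with n hn
    have h3 : ((m : ℝ) + 1) ^ 2 * ‖Y (θ^[n] ω)‖ ^ 2 ≤ n := not_lt.1 hn
    rw [one_div, le_inv_mul_iff₀ (by positivity)]
    refine le_trans ?_ (sqrt_le_lilNorm n)
    exact Real.le_sqrt_of_sq_le (by rw [mul_pow]; exact h3)
  filter_upwards [ae_all_iff.2 key] with ω hω
  rw [isLittleO_iff]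
  intro c hc
  obtain ⟨m, hm⟩ := exists_nat_one_div_lt hc
  filter_upwards [hω m] with n hn
  rw [Real.norm_of_nonneg (lilNorm_nonneg n)]
  refine hn.trans ?_
  have := lilNorm_nonneg n
  gcongr

/-- The Birkhoff sums of `Z` are almost surely negligible with respect to `lilNorm`. -/
def IsNegligible (θ : Ω → Ω) (Z : Lp H 2 μ) : Prop :=
  ∀ᵐ ω ∂μ, (fun n : ℕ => birkhoffSum θ Z n ω) =o[atTop] lilNorm

lemma IsNegligible.add (hθ : MeasurePreserving θ μ μ) {Y Z : Lp H 2 μ} (hY : IsNegligible θ Y)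
    (hZ : IsNegligible θ Z) : IsNegligible θ (Y + Z) := by
  filter_upwards [hY, hZ, ae_birkhoffSum_congr hθ (Lp.coeFn_add Y Z)] with ω h1 h2 h3
  simp only [h3]
  refine (h1.add h2).congr_left fun n => ?_
  simp [birkhoffSum, Finset.sum_add_distrib]

lemma isNegligible_zero (hθ : MeasurePreserving θ μ μ) : IsNegligible θ (0 : Lp H 2 μ) := by
  filter_upwards [ae_birkhoffSum_congr hθ (Lp.coeFn_zero H 2 μ)] with ω h3
  simp only [h3]
  refine (isLittleO_zero _ _).congr_left fun n => ?_
  simp [birkhoffSum]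

lemma IsNegligible.sum (hθ : MeasurePreserving θ μ μ) {y : ℕ → Lp H 2 μ}
    (hy : ∀ n, IsNegligible θ (y n)) (m : ℕ) : IsNegligible θ (∑ n ∈ Finset.range m, y n) := by
  induction m with
  | zero => simpa using isNegligible_zero hθ
  | succ m ih =>
    rw [Finset.sum_range_succ]
    exact ih.add hθ (hy m)

/-- The infimum over `m` has zero `L^p` norm, so it vanishes almost surely; no subsequence is
needed. -/
lemma ae_exists_maximalFunction_lt (hθ : MeasurePreserving θ μ μ) {p : ℝ} (hp : 0 < p)
    {R : ℕ → Lp H 2 μ} (hR : Tendsto (fun m => maxNorm θ p (R m)) atTop (nhds 0)) :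
    ∀ᵐ ω ∂μ, ∀ c : ℝ≥0∞, 0 < c → ∃ m, maximalFunction θ (R m) ω < c := by
  set g : Ω → ℝ≥0∞ := fun ω => ⨅ m, maximalFunction θ (R m) ω with hg
  have hgm : Measurable g := Measurable.iInf fun m => measurable_maximalFunction_lp hθ (R m)
  have h1 : ∀ m, eLpNorm g (ENNReal.ofReal p) μ ≤ maxNorm θ p (R m) := fun m =>
    eLpNorm_mono_enorm fun ω => by
      simpa only [enorm_eq_self] using iInf_le (fun m => maximalFunction θ (R m) ω) m
  have h2 : eLpNorm g (ENNReal.ofReal p) μ = 0 :=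
    le_antisymm (ge_of_tendsto' hR h1) zero_le
  have h3 := (eLpNorm_eq_zero_iff hgm.aestronglyMeasurable (by simpa using hp)).1 h2
  filter_upwards [h3] with ω hω c hc
  have h4 : ⨅ m, maximalFunction θ (R m) ω < c := by
    have : (⨅ m, maximalFunction θ (R m) ω) = 0 := hω
    rwa [this]
  exact iInf_lt_iff.1 h4

/-- The Banach principle: the maximal function of `R m` bounds its sums uniformly in `n`, so for
almost every point a suitable `m` leaves an arbitrarily small error. -/
lemma isNegligible_of_approx (hθ : MeasurePreserving θ μ μ) {p : ℝ} (hp : 0 < p)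
    {Z : Lp H 2 μ} {W R : ℕ → Lp H 2 μ} (hZ : ∀ m, Z = W m + R m)
    (hW : ∀ m, IsNegligible θ (W m))
    (hR : Tendsto (fun m => maxNorm θ p (R m)) atTop (nhds 0)) : IsNegligible θ Z := by
  have h1 : ∀ᵐ ω ∂μ, ∀ m n,
      birkhoffSum θ Z n ω = birkhoffSum θ (W m) n ω + birkhoffSum θ (R m) n ω := by
    refine ae_all_iff.2 fun m => ?_
    have h : (Z : Ω → H) =ᵐ[μ] W m + R m := by
      rw [hZ m]
      exact Lp.coeFn_add _ _
    filter_upwards [ae_birkhoffSum_congr hθ h] with ω hω n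
    rw [hω]
    simp [birkhoffSum, Finset.sum_add_distrib]
  filter_upwards [h1, ae_all_iff.2 hW, ae_exists_maximalFunction_lt hθ hp hR] with ω h1 h2 h3
  rw [isLittleO_iff]
  intro c hc
  obtain ⟨m, hm⟩ := h3 (ENNReal.ofReal (c / 2)) (by simpa using hc)
  have h4 := norm_birkhoffSum_le_of_maximalFunction_le (by positivity) hm.le
  filter_upwards [(isLittleO_iff.1 (h2 m)) (half_pos hc)] with n hn
  rw [Real.norm_of_nonneg (lilNorm_nonneg n)] at hn ⊢
  rw [h1 m n]
  have := h4 n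
  refine (norm_add_le _ _).trans ?_
  linarith

variable [InnerProductSpace ℝ H]

/-- The sums telescope to `Y ∘ θ^n - Y`. -/
lemma isNegligible_koopman_sub [IsProbabilityMeasure μ] (hθ : MeasurePreserving θ μ μ)
    (Y : Lp H 2 μ) : IsNegligible θ (koopman hθ Y - Y) := by
  have h : ((koopman hθ Y - Y : Lp H 2 μ) : Ω → H) =ᵐ[μ] fun ω => Y (θ ω) - Y ω := by
    filter_upwards [Lp.coeFn_sub (koopman hθ Y) Y, coeFn_koopman hθ Y] with ω h1 h2
    rw [h1, Pi.sub_apply, h2, Function.comp_apply]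
  filter_upwards [ae_birkhoffSum_congr hθ h,
    ae_isLittleO_iterate hθ (Lp.stronglyMeasurable Y) (Lp.memLp Y)] with ω h1 h2
  have h3 : (fun _ : ℕ => Y ω) =o[atTop] lilNorm :=
    isLittleO_const_left.2 (Or.inr (tendsto_norm_atTop_atTop.comp tendsto_lilNorm))
  refine (h2.sub h3).congr_left fun n => ?_
  rw [h1, ← birkhoffSum_apply_sub_birkhoffSum, ← birkhoffSum_comp_self]
  exact (birkhoffSum_sub θ (Y ∘ θ) Y n ω).symm

lemma isNegligible_iterate_koopman_sub [IsProbabilityMeasure μ] (hθ : MeasurePreserving θ μ μ)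
    (Y : Lp H 2 μ) (n : ℕ) : IsNegligible θ ((koopman hθ)^[n] Y - Y) := by
  induction n with
  | zero => simpa using isNegligible_zero hθ
  | succ n ih =>
    have h := (isNegligible_koopman_sub hθ ((koopman hθ)^[n] Y)).add hθ ih
    rwa [sub_add_sub_cancel, ← Function.iterate_succ_apply' (koopman hθ) n Y] at h

variable [CompleteSpace H]

/-- The reverse martingale approximation. -/
lemma exists_isNegligible_sub [IsProbabilityMeasure μ] {p : ℝ} (hp : 1 ≤ p) {C : ℝ≥0∞}
    (hCtop : C ≠ ⊤) (hC : ∀ d : Ω → H, IsReverseDiff μ θ d →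
      eLpNorm (maximalFunction θ d) (ENNReal.ofReal p) μ ≤ C * eLpNorm d 2 μ)
    (hθ : MeasurePreserving θ μ μ) {X : Ω → H} (hX : MemLp X 2 μ) (hs : SeriesFinite hθ hX) :
    ∃ D : Lp H 2 μ, perronFrobenius hθ D = 0 ∧ IsNegligible θ (hX.toLp X - D) := by
  have hK := inner_perronFrobenius (H := H) hθ
  set U := koopman (H := H) hθ with hU
  set d := diffTerm U (perronFrobenius hθ) (hX.toLp X) with hd
  have hdn : Summable fun n => ‖d n‖ := summable_norm_diffTerm hK hs
  have hds : Summable d := hdn.of_norm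
  have hsum : HasSum (fun n => U^[n] (d n) - d n) (hX.toLp X - ∑' n, d n) :=
    (hasSum_iterate_diffTerm hK hs).sub hds.hasSum
  refine ⟨∑' n, d n, ?_, ?_⟩
  · rw [ContinuousLinearMap.map_tsum _ hds]
    simp only [hd, map_diffTerm hK, tsum_zero]
  · refine isNegligible_of_approx hθ (p := p) (by linarith)
      (W := fun m => ∑ n ∈ Finset.range m, (U^[n] (d n) - d n))
      (R := fun m => hX.toLp X - ∑' n, d n - ∑ n ∈ Finset.range m, (U^[n] (d n) - d n))
      (fun m => (add_sub_cancel _ _).symm)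
      (fun m => IsNegligible.sum hθ (fun n => isNegligible_iterate_koopman_sub hθ _ n) m) ?_
    have hfin : ∑' n, 2 * (C * ‖d n‖ₑ) ≠ ⊤ := by
      rw [ENNReal.tsum_mul_left, ENNReal.tsum_mul_left]
      refine ENNReal.mul_ne_top ENNReal.ofNat_ne_top (ENNReal.mul_ne_top hCtop ?_)
      exact ((tsum_enorm_diffTerm_le hθ hX hs).trans_lt ENNReal.ofReal_lt_top).ne
    refine tendsto_of_tendsto_of_tendsto_of_le_of_le tendsto_const_nhds
      (ENNReal.tendsto_sum_nat_add _ hfin) (fun _ => zero_le) fun m => ?_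
    refine (maxNorm_le_tsum hθ hp ((hasSum_nat_add_iff' m).2 hsum)).trans
      (ENNReal.tsum_le_tsum fun n => ?_)
    refine (maxNorm_sub_le hθ hp _ _).trans ?_
    rw [maxNorm_iterate_koopman, ← two_mul]
    gcongr
    exact maxNorm_le_of_perronFrobenius_eq_zero hC hθ (map_diffTerm hK _ _)

/-- Sets of the pulled back σ-algebra are preimages of `B`; testing with vectors `h` supported on
`B` shows that the vector integrals vanish. -/
lemma IsReverseDiff.condExp_eq_zero [IsProbabilityMeasure μ] (hθ : MeasurePreserving θ μ μ)
    {d : Ω → H} (hd : IsReverseDiff μ θ d) : μ[d | MeasurableSpace.comap θ mΩ] =ᵐ[μ] 0 := by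
  have hdi : Integrable d μ := hd.memLp.integrable one_le_two
  refine (ae_eq_condExp_of_forall_setIntegral_eq hθ.measurable.comap_le hdi
    (fun _ _ _ => integrableOn_zero) ?_ aestronglyMeasurable_zero).symm
  rintro _ ⟨B, hB, rfl⟩ -
  simp only [integral_zero]
  refine (ext_inner_left ℝ fun h => ?_).symm
  rw [inner_zero_right, ← integral_inner hdi.integrableOn,
    ← integral_indicator (hθ.measurable hB)]
  rw [← hd.orth (B.indicator fun _ => h) ((memLp_const h).indicator hB)]
  refine integral_congr_ae (Eventually.of_forall fun ω => ?_)
  by_cases hω : θ ω ∈ B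
  · simp [Set.indicator_of_mem hω, Set.indicator_of_mem (show ω ∈ θ ⁻¹' B from hω)]
  · simp [Set.indicator_of_notMem hω, Set.indicator_of_notMem (show ω ∉ θ ⁻¹' B from hω)]

end Approximation

/-! ### Relative compactness through finite-dimensional projections. -/

section Compact

variable {Ω : Type u} [MeasurableSpace Ω] {μ : Measure Ω} {H : Type v} [NormedAddCommGroup H]
  [InnerProductSpace ℝ H] {θ : Ω → Ω}

/-- The values of an approximating simple function `s` span `F`, and the projection error of `d` is
the orthogonal projection of `d - s` onto the complement of `F`. -/
lemma exists_finiteDimensional_approx {d : Ω → H} (hd : MemLp d 2 μ) {c : ℝ≥0∞} (hc : c ≠ 0) :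
    ∃ F : Submodule ℝ H, ∃ _ : FiniteDimensional ℝ F,
      eLpNorm (fun ω => d ω - F.starProjection (d ω)) 2 μ ≤ c := by
  obtain ⟨s, hs, -⟩ := hd.exists_simpleFunc_eLpNorm_sub_lt ENNReal.ofNat_ne_top hc
  have hF : FiniteDimensional ℝ (Submodule.span ℝ (Set.range s)) :=
    FiniteDimensional.span_of_finite ℝ s.finite_range
  refine ⟨Submodule.span ℝ (Set.range s), hF, le_trans (eLpNorm_mono fun ω => ?_) hs.le⟩
  set F := Submodule.span ℝ (Set.range s)
  have hmem : s ω ∈ F := Submodule.subset_span ⟨ω, rfl⟩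
  have h1 : d ω - F.starProjection (d ω) = Fᗮ.starProjection (d ω - s ω) := by
    rw [Submodule.starProjection_orthogonal_val, map_sub,
      Submodule.starProjection_eq_self_iff.2 hmem]
    abel
  rw [h1]
  exact Fᗮ.norm_starProjection_apply_le _

variable [CompleteSpace H]

lemma IsReverseDiff.continuousLinearMap_comp (A : H →L[ℝ] H) {d : Ω → H}
    (hd : IsReverseDiff μ θ d) : IsReverseDiff μ θ fun ω => A (d ω) where
  memLp := A.comp_memLp' hd.memLp
  orth Y hY := by
    have h := hd.orth (fun ω => ContinuousLinearMap.adjoint A (Y ω))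
      (ContinuousLinearMap.comp_memLp' _ hY)
    simpa only [ContinuousLinearMap.adjoint_inner_left] using h

/-- The Birkhoff sums of a reverse martingale difference, divided by `lilNorm`, almost surely stay
within any prescribed distance of a compact set. -/
lemma IsReverseDiff.ae_exists_compact_approx [IsProbabilityMeasure μ] {p : ℝ} (hp : 1 ≤ p)
    {C : ℝ≥0∞} (hCtop : C ≠ ⊤) (hC : ∀ d : Ω → H, IsReverseDiff μ θ d →
      eLpNorm (maximalFunction θ d) (ENNReal.ofReal p) μ ≤ C * eLpNorm d 2 μ)
    (hθ : MeasurePreserving θ μ μ) {d : Ω → H} (hd : IsReverseDiff μ θ d) :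
    ∀ᵐ ω ∂μ, ∀ c : ℝ, 0 < c → ∃ T : Set H, IsCompact T ∧ ∀ n : ℕ, 1 ≤ n →
      ∃ y ∈ T, ‖(lilNorm n)⁻¹ • birkhoffSum θ d n ω - y‖ ≤ c := by
  have hp0 : 0 < p := by linarith
  choose F hF hFd using fun m : ℕ => exists_finiteDimensional_approx (c := ((m : ℝ≥0∞) + 1)⁻¹)
    hd.memLp (ENNReal.inv_ne_zero.2 (by finiteness))
  have hr : ∀ m, IsReverseDiff μ θ fun ω => d ω - (F m).starProjection (d ω) := fun m =>
    hd.continuousLinearMap_comp (ContinuousLinearMap.id ℝ H - (F m).starProjection)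
  have hR : Tendsto (fun m => maxNorm θ p ((hr m).memLp.toLp _)) atTop (nhds 0) := by
    have h0 : Tendsto (fun m : ℕ => C * ((m : ℝ≥0∞) + 1)⁻¹) atTop (nhds 0) := by
      have h1 : Tendsto (fun m : ℕ => ((m : ℝ≥0∞) + 1)⁻¹) atTop (nhds 0) := by
        have := (tendsto_add_atTop_iff_nat 1).2 ENNReal.tendsto_inv_nat_nhds_zero
        simpa using this
      simpa using ENNReal.Tendsto.const_mul h1 (Or.inr hCtop)
    refine tendsto_of_tendsto_of_tendsto_of_le_of_le tendsto_const_nhds h0 (fun _ => zero_le)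
      fun m => ?_
    simp only [maxNorm_toLp hθ]
    refine (hC _ (hr m)).trans ?_
    gcongr
    exact hFd m
  have hfin : ∀ᵐ ω ∂μ, maximalFunction θ d ω < ⊤ := by
    have h1 : maxNorm θ p (hd.memLp.toLp d) < ⊤ := by
      rw [maxNorm_toLp hθ]
      exact (hC d hd).trans_lt (ENNReal.mul_lt_top hCtop.lt_top hd.memLp.2)
    rw [maxNorm_eq_lintegral hp0, ENNReal.rpow_lt_top_iff_of_pos (by positivity)] at h1
    filter_upwards [ae_lt_top ((measurable_maximalFunction_lp hθ _).pow_const p) h1.ne,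
      maximalFunction_congr hθ hd.memLp.coeFn_toLp] with ω h2 h3
    rw [h3] at h2
    exact (ENNReal.rpow_lt_top_iff_of_pos hp0).1 h2
  have hcongr : ∀ᵐ ω ∂μ, ∀ m, maximalFunction θ ((hr m).memLp.toLp _) ω
      = maximalFunction θ (fun ω => d ω - (F m).starProjection (d ω)) ω :=
    ae_all_iff.2 fun m => maximalFunction_congr hθ (hr m).memLp.coeFn_toLp
  filter_upwards [ae_exists_maximalFunction_lt hθ hp0 hR, hfin, hcongr] with ω h1 h2 h3 c hc
  obtain ⟨m, hm⟩ := h1 (ENNReal.ofReal c) (by simpa using hc)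
  rw [h3] at hm
  have := hF m
  set b := (maximalFunction θ d ω).toReal with hb
  have h4 := norm_birkhoffSum_le_of_maximalFunction_le ENNReal.toReal_nonneg
    (ENNReal.ofReal_toReal h2.ne).ge
  have h5 := norm_birkhoffSum_le_of_maximalFunction_le hc.le hm.le
  -- The projected sums stay in the ball of `F m` whose radius is the maximal function of `d` at
  -- `ω`; compactness uses finite dimension.
  refine ⟨(↑) '' Metric.closedBall (0 : F m) b,
    (isCompact_closedBall (0 : F m) b).image continuous_subtype_val, fun n hn => ?_⟩
  have hl := lilNorm_pos hn
  refine ⟨(F m).starProjection ((lilNorm n)⁻¹ • birkhoffSum θ d n ω),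
    ⟨⟨_, Submodule.starProjection_apply_mem _ _⟩, ?_, rfl⟩, ?_⟩
  · rw [mem_closedBall_zero_iff, Submodule.coe_norm]
    refine ((F m).norm_starProjection_apply_le _).trans ?_
    rw [norm_smul, norm_inv, Real.norm_of_nonneg hl.le, inv_mul_le_iff₀ hl, mul_comm]
    exact h4 n
  · have h6 : birkhoffSum θ (fun ω => d ω - (F m).starProjection (d ω)) n ω
        = birkhoffSum θ d n ω - (F m).starProjection (birkhoffSum θ d n ω) := by
      simp [birkhoffSum, Finset.sum_sub_distrib, map_sum]
    rw [map_smul, ← smul_sub, ← h6, norm_smul, norm_inv, Real.norm_of_nonneg hl.le,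
      inv_mul_le_iff₀ hl, mul_comm]
    exact h5 n

omit [InnerProductSpace ℝ H] [CompleteSpace H] in
lemma totallyBounded_of_compact_approx {S : ℕ → H}
    (h : ∀ c : ℝ, 0 < c → ∃ T : Set H, IsCompact T ∧ ∀ᶠ n in atTop, ∃ y ∈ T, ‖S n - y‖ ≤ c)
    (I : Set ℕ) : TotallyBounded (S '' I) := by
  rw [Metric.totallyBounded_iff]
  intro ε hε
  obtain ⟨T, hT, hST⟩ := h (ε / 2) (half_pos hε)
  obtain ⟨N, hN⟩ := eventually_atTop.1 hST
  obtain ⟨t, ht, hTt⟩ := Metric.totallyBounded_iff.1 hT.totallyBounded (ε / 2) (half_pos hε)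
  -- The finitely many early terms are put into the net themselves.
  refine ⟨t ∪ S '' Set.Iio N, ht.union ((Set.finite_Iio N).image S), ?_⟩
  rintro _ ⟨n, -, rfl⟩
  rw [Set.mem_iUnion₂]
  rcases lt_or_ge n N with hn | hn
  · exact ⟨S n, Or.inr ⟨n, hn, rfl⟩, Metric.mem_ball_self hε⟩
  · obtain ⟨y, hy, hSy⟩ := hN n hn
    obtain ⟨z, hz, hyz⟩ := Set.mem_iUnion₂.1 (hTt hy)
    refine ⟨z, Or.inl hz, ?_⟩
    rw [Metric.mem_ball] at hyz ⊢
    have h1 := dist_triangle (S n) y z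
    rw [dist_eq_norm (S n) y] at h1
    linarith

lemma compactLIL_of_isLittleO {X d : Ω → H}
    (hd : ∀ᵐ ω ∂μ, ∀ c : ℝ, 0 < c → ∃ T : Set H, IsCompact T ∧ ∀ n : ℕ, 1 ≤ n →
      ∃ y ∈ T, ‖(lilNorm n)⁻¹ • birkhoffSum θ d n ω - y‖ ≤ c)
    (hXd : ∀ᵐ ω ∂μ, (fun n : ℕ => birkhoffSum θ X n ω - birkhoffSum θ d n ω) =o[atTop] lilNorm) :
    CompactLIL μ θ X := by
  filter_upwards [hd, hXd] with ω h1 h2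
  refine TotallyBounded.isCompact_of_isClosed (TotallyBounded.closure ?_) isClosed_closure
  refine totallyBounded_of_compact_approx (fun c hc => ?_) _
  obtain ⟨T, hT, hTd⟩ := h1 (c / 2) (half_pos hc)
  refine ⟨(fun y => (√2)⁻¹ • y) '' T, hT.image (continuous_const_smul _), ?_⟩
  filter_upwards [(isLittleO_iff.1 h2) (half_pos hc), eventually_ge_atTop 1] with n hn hn1
  have hl := lilNorm_pos hn1
  obtain ⟨y, hy, hyd⟩ := hTd n hn1
  refine ⟨_, ⟨y, hy, rfl⟩, ?_⟩
  have h3 : √(2 * (n : ℝ) * L (L (n : ℝ))) = √2 * lilNorm n := by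
    rw [lilNorm, ← Real.sqrt_mul zero_le_two, mul_assoc]
  have h4 : (√(2 * (n : ℝ) * L (L (n : ℝ))))⁻¹ • birkhoffSum θ X n ω - (√2)⁻¹ • y
      = (√2)⁻¹ • ((lilNorm n)⁻¹ • (birkhoffSum θ X n ω - birkhoffSum θ d n ω)
        + ((lilNorm n)⁻¹ • birkhoffSum θ d n ω - y)) := by
    rw [h3, mul_inv, mul_smul, smul_sub (lilNorm n)⁻¹, ← smul_sub]
    congr 1
    abel
  have h5 : (√2)⁻¹ ≤ 1 := inv_le_one_of_one_le₀ (Real.one_le_sqrt.2 one_le_two)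
  have h6 : ‖(lilNorm n)⁻¹ • (birkhoffSum θ X n ω - birkhoffSum θ d n ω)‖ ≤ c / 2 := by
    rw [norm_smul, norm_inv, Real.norm_of_nonneg hl.le, inv_mul_le_iff₀ hl, mul_comm]
    rwa [Real.norm_of_nonneg hl.le] at hn
  rw [h4, norm_smul, norm_inv, Real.norm_of_nonneg (Real.sqrt_nonneg 2)]
  refine (mul_le_of_le_one_left (norm_nonneg _) h5).trans ((norm_add_le _ _).trans ?_)
  linarith

end Compact
end LILDynSys

theorem mainTheorem5 :
    (∀ p : ℝ, 1 < p → p < 2 → ∃ C : ℝ, 0 < C ∧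
      ∀ (Ω : Type u) [MeasurableSpace Ω] (μ : Measure Ω) [IsProbabilityMeasure μ]
        (θ : Ω → Ω) (hθ : MeasurePreserving θ μ μ)
        (H : Type v) [NormedAddCommGroup H] [InnerProductSpace ℝ H] [CompleteSpace H]
        (X : Ω → H) (hX : MemLp X 2 μ), LILDynSys.SeriesFinite hθ hX →
        eLpNorm (LILDynSys.maximalFunction θ X) (ENNReal.ofReal p) μ ≤
          ENNReal.ofReal (C * LILDynSys.seriesNorm hθ hX)) ∧
    (∀ (Ω : Type u) [mΩ : MeasurableSpace Ω] (μ : Measure Ω) [IsProbabilityMeasure μ]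
        (θ : Ω → Ω) (hθ : MeasurePreserving θ μ μ)
        (H : Type v) [NormedAddCommGroup H] [InnerProductSpace ℝ H] [CompleteSpace H]
        (X : Ω → H) (hX : MemLp X 2 μ), LILDynSys.SeriesFinite hθ hX →
        (∃ d : Ω → H, MemLp d 2 μ ∧
          μ[d | MeasurableSpace.comap θ mΩ] =ᵐ[μ] 0 ∧
          ∀ᵐ ω ∂μ, (fun n : ℕ => birkhoffSum θ X n ω - birkhoffSum θ d n ω) =o[atTop]
            LILDynSys.lilNorm) ∧
        LILDynSys.CompactLIL μ θ X) := by
  refine ⟨fun p hp1 hp2 => ?_, ?_⟩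
  · obtain ⟨C, hCtop, hC⟩ := LILDynSys.exists_eLpNorm_maximalFunction_le.{u, v} hp1 hp2
    -- The added 1 only ensures that the constant is positive.
    refine ⟨2 * C.toReal + 1, by positivity, ?_⟩
    intro Ω _ μ _ θ hθ H _ _ _ X hX hs
    have hN : 0 ≤ LILDynSys.seriesNorm hθ hX :=
      add_nonneg (norm_nonneg _) (tsum_nonneg fun _ => div_nonneg (norm_nonneg _)
        (Real.sqrt_nonneg _))
    refine (LILDynSys.eLpNorm_maximalFunction_le_seriesNorm (hC Ω μ θ hθ H) hp1.le hθ hX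
      hs).trans ?_
    rw [← ENNReal.ofReal_toReal hCtop, ← ENNReal.ofReal_mul ENNReal.toReal_nonneg]
    refine ENNReal.ofReal_le_ofReal ?_
    rw [ENNReal.ofReal_toReal hCtop]
    linarith
  · intro Ω mΩ μ _ θ hθ H _ _ _ X hX hs
    -- Any exponent strictly between 1 and 2 would serve here.
    obtain ⟨C, hCtop, hC⟩ := LILDynSys.exists_eLpNorm_maximalFunction_le.{u, v}
      (p := 3 / 2) (by norm_num) (by norm_num)
    have hC' := hC Ω μ θ hθ H
    obtain ⟨D, hD, hneg⟩ := LILDynSys.exists_isNegligible_sub (by norm_num) hCtop hC' hθ hX hs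
    have hrev := LILDynSys.isReverseDiff_of_perronFrobenius_eq_zero hθ hD
    have hXD : ∀ᵐ ω ∂μ, (fun n : ℕ => birkhoffSum θ X n ω - birkhoffSum θ D n ω) =o[atTop]
        LILDynSys.lilNorm := by
      have h : ((hX.toLp X - D : Lp H 2 μ) : Ω → H) =ᵐ[μ] X - D := by
        filter_upwards [Lp.coeFn_sub (hX.toLp X) D, hX.coeFn_toLp] with ω h1 h2
        rw [h1, Pi.sub_apply, Pi.sub_apply, h2]
      filter_upwards [hneg, LILDynSys.ae_birkhoffSum_congr hθ h] with ω h1 h2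
      refine h1.congr_left fun n => ?_
      rw [h2]
      exact birkhoffSum_sub θ X D n ω
    exact ⟨⟨D, hrev.memLp, hrev.condExp_eq_zero hθ, hXD⟩,
      LILDynSys.compactLIL_of_isLittleO
        (hrev.ae_exists_compact_approx (by norm_num) hCtop hC' hθ) hXD⟩
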